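/- Conventions. Complex manifolds are finite-dimensional (of pure dimension), Hausdorff and second countable, not necessarily connected. A Stein manifold is a complex manifold that is holomorphically convex and whose points are separated by global holomorphic functions; a Stein inclusion $T\hookrightarrow S$ is the inclusion of a closed complex submanifold $T$ in a Stein manifold $S$. For a topological space $P$, a map $g$ on $S\times P$ is holomorphic along $S$ if $g(\cdot,p)$ is holomorphic for every $p\in P$. A map $f:X\to Y$ of complex manifolds has the parametric Oka property with interpolation (POPI) if for every Stein inclusion $T\hookrightarrow S$, every finite polyhedron $P$ with a subpolyhedron $Q$, and every continuous map $g:S\times P\to X$ such that $g|_{S\times Q}$ is holomorphic along $S$, $g|_{T\times P}$ is holomorphic along $T$, and $f\circ g$ is holomorphic along $S$, there is a continuous map $G:S\times P\times[0,1]\to X$ such that (i) $G(\cdot,\cdot,0)=g$; (ii) $G(\cdot,\cdot,1)$ is holomorphic along $S$; (iii) $G(\cdot,\cdot,t)=g$ on $S\times Q$ and on $T\times P$ for all $t\in[0,1]$; (iv) $f\circ G(\cdot,\cdot,t)=f\circ g$ on $S\times P$ for all $t\in[0,1]$. A complex manifold $X$ has the parametric Oka property if the constant map from $X$ to a point satisfies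 POPI. A holomorphic map is an intermediate fibration if it is a topological (Serre) fibration and satisfies POPI. It is acyclic if it is a weak homotopy equivalence. Theorem. Let $X$ and $Y$ be complex manifolds and let $f:X\to Y$ be a holomorphic map which is an intermediate fibration. (1) If $Y$ has the parametric Oka property, then so does $X$. (2) If $f$ is acyclic and $X$ has the parametric Oka property, then so does $Y$. -/

import Mathlib

open scoped Manifold ContDiff

/-- The model space `ℂⁿ` of complex `n`-dimensional manifolds. -/
abbrev Cn (n : ℕ) : Type := EuclideanSpace ℂ (Fin n)

section Topology

variable {X Y : Type*} [TopologicalSpace X] [TopologicalSpace Y]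

/-- A (Serre) fibration: a continuous map with the homotopy lifting property with respect to all
cubes `[0,1]^k`, `k ≥ 0`. -/
def IsSerreFibration (f : X → Y) : Prop :=
  Continuous f ∧
    ∀ (k : ℕ) (H : C((Fin k → unitInterval) × unitInterval, Y))
      (h₀ : C(Fin k → unitInterval, X)),
      (∀ u, f (h₀ u) = H (u, 0)) →
        ∃ L : C((Fin k → unitInterval) × unitInterval, X), (∀ u, L (u, 0) = h₀ u) ∧ ∀ z, f (L z) = H z

/-- The map on sets of path components induced by a continuous map. -/
def zerothHomotopyMap (f : C(X, Y)) : ZerothHomotopy X → ZerothHomotopy Y :=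
  Quotient.map f fun _ _ h => h.map f.continuous

/-- The map on generalized loops induced by a continuous map. -/
def genLoopMap (f : C(X, Y)) (k : ℕ) (x : X) (γ : GenLoop (Fin k) X x) :
    GenLoop (Fin k) Y (f x) :=
  ⟨f.comp γ.1, fun y hy => congrArg f (γ.2 y hy)⟩

/-- The map `π_k (X, x) → π_k (Y, f x)` induced by a continuous map. -/
def homotopyGroupMap (f : C(X, Y)) (k : ℕ) (x : X) :
    HomotopyGroup.Pi k X x → HomotopyGroup.Pi k Y (f x) :=
  Quotient.map (genLoopMap f k x) fun _ _ h => h.map fun F => F.compContinuousMap f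

/-- A weak homotopy equivalence: a continuous map that induces a bijection of path components
and isomorphisms of all homotopy groups at all base points. -/
def IsWeakHomotopyEquiv (f : X → Y) : Prop :=
  ∃ hf : Continuous f,
    Function.Bijective (zerothHomotopyMap ⟨f, hf⟩) ∧
      ∀ (k : ℕ) (x : X), 1 ≤ k → Function.Bijective (homotopyGroupMap ⟨f, hf⟩ k x)

end Topology

/-- Holomorphic maps between complex manifolds. -/
abbrev IsHolomorphic {m n : ℕ} {X Y : Type*} [TopologicalSpace X] [ChartedSpace (Cn m) X]
    [TopologicalSpace Y] [ChartedSpace (Cn n) Y] (f : X → Y) : Prop :=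
  MDifferentiable 𝓘(ℂ, Cn m) 𝓘(ℂ, Cn n) f

/-- The hull of `K` with respect to the holomorphic functions on `S`: the points `x` with
`|φ x| ≤ sup_K |φ|` for every holomorphic function `φ` on `S`. -/
def holomorphicHull {a : ℕ} {S : Type*} [TopologicalSpace S] [ChartedSpace (Cn a) S]
    (K : Set S) : Set S :=
  {x | ∀ φ : S → ℂ, MDifferentiable 𝓘(ℂ, Cn a) 𝓘(ℂ) φ →
    ∀ C : ℝ, (∀ y ∈ K, ‖φ y‖ ≤ C) → ‖φ x‖ ≤ C}

/-- A Stein manifold of dimension `a`: a (Hausdorff, second countable) complex manifold that is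
holomorphically convex and whose points are separated by global holomorphic functions. -/
structure IsSteinManifold (a : ℕ) (S : Type*) [TopologicalSpace S] [ChartedSpace (Cn a) S] :
    Prop where
  t2Space : T2Space S
  secondCountable : SecondCountableTopology S
  isManifold : IsManifold 𝓘(ℂ, Cn a) ω S
  holomorphicallyConvex : ∀ K : Set S, IsCompact K → IsCompact (holomorphicHull (a := a) K)
  separatesPoints : ∀ x y : S, x ≠ y →
    ∃ φ : S → ℂ, MDifferentiable 𝓘(ℂ, Cn a) 𝓘(ℂ) φ ∧ φ x ≠ φ y

/-- `ι : T → S` is a Stein inclusion: `S` is a Stein manifold and `ι` embeds the complex manifold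
`T` onto a closed complex submanifold of `S`. -/
structure IsSteinInclusion (b a : ℕ) {T S : Type*} [TopologicalSpace T] [ChartedSpace (Cn b) T]
    [TopologicalSpace S] [ChartedSpace (Cn a) S] (ι : T → S) : Prop where
  stein : IsSteinManifold a S
  isManifold : IsManifold 𝓘(ℂ, Cn b) ω T
  isEmbedding : Manifold.IsSmoothEmbedding 𝓘(ℂ, Cn b) 𝓘(ℂ, Cn a) ω ι
  isClosed_range : IsClosed (Set.range ι)

/-- The parametric Oka property with interpolation (POPI) of a map `f : X → Y` of complex
manifolds. The finite polyhedron `P` is the underlying space of a finite simplicial complex `K`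
in some `ℝᵈ`, and its subpolyhedron `Q` is the underlying space of a subcomplex `L`.
Every Stein manifold is biholomorphic to one whose underlying set is in `Type`. -/
def HasPOPI {m n : ℕ} {X Y : Type*} [TopologicalSpace X] [ChartedSpace (Cn m) X]
    [TopologicalSpace Y] [ChartedSpace (Cn n) Y] (f : X → Y) : Prop :=
  ∀ (a b : ℕ) (S T : Type) [TopologicalSpace S] [ChartedSpace (Cn a) S]
    [TopologicalSpace T] [ChartedSpace (Cn b) T] (ι : T → S), IsSteinInclusion b a ι →
  ∀ (d : ℕ) (K L : Geometry.SimplicialComplex ℝ (EuclideanSpace ℝ (Fin d))),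
    K.faces.Finite → L ≤ K →
  ∀ g : C(S × K.space, X),
    (∀ q : K.space, (q : EuclideanSpace ℝ (Fin d)) ∈ L.space →
      IsHolomorphic (m := a) (n := m) fun s => g (s, q)) →
    (∀ p : K.space, IsHolomorphic (m := b) (n := m) fun t => g (ι t, p)) →
    (∀ p : K.space, IsHolomorphic (m := a) (n := n) fun s => f (g (s, p))) →
    ∃ G : C((S × K.space) × unitInterval, X),
      (∀ z, G (z, 0) = g z) ∧
      (∀ p : K.space, IsHolomorphic (m := a) (n := m) fun s => G ((s, p), 1)) ∧
      (∀ (s : S) (q : K.space) (t : unitInterval), (q : EuclideanSpace ℝ (Fin d)) ∈ L.space →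
        G ((s, q), t) = g (s, q)) ∧
      (∀ (x : T) (p : K.space) (t : unitInterval), G ((ι x, p), t) = g (ι x, p)) ∧
      ∀ z t, f (G (z, t)) = f (g z)

/-- The parametric Oka property of a complex manifold `X`: the constant map from `X` to a point
(the complex manifold `ℂ⁰`) satisfies POPI. -/
def HasParametricOka (m : ℕ) (X : Type*) [TopologicalSpace X] [ChartedSpace (Cn m) X] : Prop :=
  HasPOPI (m := m) (n := 0) fun _ : X => (0 : Cn 0)

/-- Intermediate fibrations: a holomorphic map is an intermediate fibration if it is a topological
fibration and satisfies POPI. -/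
structure IsIntermediateFibration {m n : ℕ} {X Y : Type*} [TopologicalSpace X]
    [ChartedSpace (Cn m) X] [TopologicalSpace Y] [ChartedSpace (Cn n) Y] (f : X → Y) : Prop where
  holomorphic : IsHolomorphic (m := m) (n := n) f
  fibration : IsSerreFibration f
  popi : HasPOPI (m := m) (n := n) f

/-! Holomorphy enters only through POPI and the Oka hypothesis; everything else is a relative
lifting problem in topology.

For the source: given g into X, the Oka property of Y deforms f ∘ g to a family holomorphic along S,
fixed over S × Q and T × P. This deformation lifts through the Serre fibration f, starting at g and
staying constant over S × Q and T × P. The end map has holomorphic composite with f, so POPI of f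
deforms it further to a holomorphic one.

For the target: given h into Y, lift h holomorphically over T × P, then over S × Q so that the lifts
agree on T × Q, and extend their union to a continuous lift g over S × P. The Oka property of X
deforms g, and composing with f gives the deformation of h. Each holomorphic lift is a continuous
lift corrected by POPI of f, which does not change the composite with f.

The topology needed is that an acyclic Serre fibration lifts against the inclusion of T × P ∪ S × Q
in S × P, and that a Serre fibration has the corresponding relative homotopy lifting. Both are
reduced to `IsCubeLifting`, lifting against ∂Iⁿ ⊂ Iⁿ. Acyclic Serre fibrations have it
(`IsSerreFibration.isCubeLifting`). Corner maps turn product pairs into single pairs: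
`IsCubeLifting.cornerMap_cube` handles the cells of P, and `IsSerreFibration.cornerMap_interval`
turns homotopy lifting for f into cube lifting for another map. No triangulation of S is used:
`IsCubeLifting.liftsOn_of_isSliceAt` extends lifts chart by chart, using fine grids in slice charts.
-/

open Set Topology unitInterval

/-! ### Relative lifting problems and induction over cells -/

section Lifting

variable {E B Z W : Type*} [TopologicalSpace E] [TopologicalSpace Z] [TopologicalSpace W]

/-- Every lift of `h` through `q` over `A` extends to a lift over `D`. -/
def LiftsOn (q : E → B) (h : Z → B) (A D : Set Z) : Prop :=
  ∀ g : Z → E, ContinuousOn g A → (∀ z ∈ A, q (g z) = h z) →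
    ∃ g' : Z → E, ContinuousOn g' D ∧ EqOn g' g A ∧ ∀ z ∈ D, q (g' z) = h z

theorem LiftsOn.refl (q : E → B) (h : Z → B) (A : Set Z) : LiftsOn q h A A :=
  fun g hg hq => ⟨g, hg, fun _ _ => rfl, hq⟩

theorem LiftsOn.trans {q : E → B} {h : Z → B} {A D D' : Set Z} (hAD : A ⊆ D)
    (h₁ : LiftsOn q h A D) (h₂ : LiftsOn q h D D') : LiftsOn q h A D' := by
  intro g hg hq
  obtain ⟨g₁, c₁, e₁, l₁⟩ := h₁ g hg hq
  obtain ⟨g₂, c₂, e₂, l₂⟩ := h₂ g₁ c₁ l₁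
  exact ⟨g₂, c₂, fun z hz => (e₂ (hAD hz)).trans (e₁ hz), l₂⟩

/-- Attaching one closed cell: the old lift and a lift over the cell agree on the overlap, and two
closed pieces glue. -/
theorem LiftsOn.union {q : E → B} {h : Z → B} {A c : Set Z} (hA : IsClosed A) (hc : IsClosed c)
    (H : LiftsOn q h (c ∩ A) c) : LiftsOn q h A (A ∪ c) := by
  classical
  intro g hg hq
  obtain ⟨g', c', e', l'⟩ := H g (hg.mono inter_subset_right) fun z hz => hq z hz.2
  have eA : EqOn (fun z => if z ∈ c then g' z else g z) g A := fun z hz => by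
    by_cases hzc : z ∈ c
    · simp [hzc, e' ⟨hzc, hz⟩]
    · simp [hzc]
  have ec : EqOn (fun z => if z ∈ c then g' z else g z) g' c := fun z hz => by simp [hz]
  refine ⟨_, (hg.congr eA).union_of_isClosed (c'.congr ec) hA hc, eA, ?_⟩
  rintro z (hz | hz)
  · exact (congrArg q (eA hz)).trans (hq z hz)
  · exact (congrArg q (ec hz)).trans (l' z hz)

theorem LiftsOn.image {q : E → B} {h : Z → B} {e : W → Z} (he : IsEmbedding e) {A D : Set W}
    (H : LiftsOn q (h ∘ e) A D) : LiftsOn q h (e '' A) (e '' D) := by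
  intro g hg hq
  obtain ⟨w, cw, ew, lw⟩ := H (g ∘ e)
    (hg.comp he.continuous.continuousOn (mapsTo_image e A)) fun z hz => hq _ ⟨z, hz, rfl⟩
  have key : ∀ z, Function.extend e w g (e z) = w z := fun z => he.injective.extend_apply _ _ _
  refine ⟨Function.extend e w g, ?_, ?_, ?_⟩
  · rintro _ ⟨z, hz, rfl⟩
    have := cw z hz
    rw [ContinuousWithinAt, ← he.map_nhdsWithin_eq, Filter.tendsto_map'_iff, key]
    exact Filter.Tendsto.congr (fun x => (key x).symm) this
  · rintro _ ⟨z, hz, rfl⟩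
    rw [key, ew hz]; rfl
  · rintro _ ⟨z, hz, rfl⟩
    rw [key, lw z hz]; rfl

theorem LiftsOn.of_homeomorph {q : E → B} {h : Z → B} (e : W ≃ₜ Z) {A : Set Z}
    (H : LiftsOn q (h ∘ e) (e ⁻¹' A) univ) : LiftsOn q h A univ := by
  have := LiftsOn.image e.isEmbedding H
  rwa [image_preimage_eq _ e.surjective, image_univ_of_surjective e.surjective] at this

/-- Extension of lifts over finitely many cells, where the carrier `sig z` is the smallest cell
containing the point `z`. -/
theorem LiftsOn.cells {Λ : Type*} (cells : Set Λ) (hfin : cells.Finite) (c : Λ → Set Z)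
    (dim : Λ → ℕ) (sig : Z → Λ) (hc : ∀ κ ∈ cells, IsClosed (c κ))
    (hsig : ∀ κ ∈ cells, ∀ z ∈ c κ, sig z ∈ cells ∧ z ∈ c (sig z) ∧ c (sig z) ⊆ c κ ∧
      (sig z = κ ∨ dim (sig z) < dim κ))
    {q : E → B} {h : Z → B} {A : Set Z} (hA : IsClosed A)
    (hq : ∀ κ ∈ cells, LiftsOn q h ({z ∈ c κ | sig z ≠ κ} ∪ (c κ ∩ A)) (c κ))
    (D : Set Z) (hD : IsClosed D) (hDc : ∀ z ∈ D, sig z ∈ cells ∧ z ∈ c (sig z) ∧ c (sig z) ⊆ D) :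
    LiftsOn q h (A ∪ D) (A ∪ ⋃ κ ∈ cells, c κ) := by
  induction hn : ({κ ∈ cells | ¬ c κ ⊆ D}).ncard using Nat.strong_induction_on generalizing D with
  | _ n ih =>
  have hfin' : ({κ ∈ cells | ¬ c κ ⊆ D}).Finite := hfin.subset (sep_subset _ _)
  rcases ({κ ∈ cells | ¬ c κ ⊆ D}).eq_empty_or_nonempty with h0 | hne
  · have : D = ⋃ κ ∈ cells, c κ := by
      apply Subset.antisymm
      · intro z hz
        obtain ⟨h1, h2, -⟩ := hDc z hz
        exact mem_biUnion h1 h2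
      · refine iUnion₂_subset fun κ hκ => ?_
        by_contra hcon
        exact (h0 ▸ (⟨hκ, hcon⟩ : κ ∈ {κ ∈ cells | ¬ c κ ⊆ D}) : κ ∈ (∅ : Set Λ))
    rw [this]
    exact LiftsOn.refl _ _ _
  -- A cell of least dimension not yet in D. Its boundary points have carriers of smaller dimension,
  -- so these already lie in D, and the problem over this cell is exactly the one in `hq`.
  · obtain ⟨κ, ⟨hκ, hκD⟩, hmin⟩ := hfin'.exists_minimalFor dim _ hne
    have hmin' : ∀ z ∈ c κ, sig z ≠ κ → c (sig z) ⊆ D := by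
      intro z hz hzκ
      by_contra hcon
      obtain ⟨h1, -, -, h3⟩ := hsig κ hκ z hz
      have := h3.resolve_left hzκ
      have := hmin ⟨h1, hcon⟩ this.le
      omega
    have hbd : c κ ∩ (A ∪ D) = {z ∈ c κ | sig z ≠ κ} ∪ (c κ ∩ A) := by
      ext z
      constructor
      · rintro ⟨hz, hzA | hzD⟩
        · exact Or.inr ⟨hz, hzA⟩
        · refine Or.inl ⟨hz, fun hzκ => hκD ?_⟩
          rw [← hzκ]
          exact (hDc z hzD).2.2
      · rintro (⟨hz, hzκ⟩ | ⟨hz, hzA⟩)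
        · exact ⟨hz, Or.inr (hmin' z hz hzκ (hsig κ hκ z hz).2.1)⟩
        · exact ⟨hz, Or.inl hzA⟩
    have step : LiftsOn q h (A ∪ D) ((A ∪ D) ∪ c κ) :=
      LiftsOn.union (hA.union hD) (hc κ hκ) (hbd ▸ hq κ hκ)
    rw [union_assoc] at step
    refine step.trans (union_subset_union_right _ subset_union_left)
      (ih _ ?_ (D ∪ c κ) (hD.union (hc κ hκ)) ?_ rfl)
    · rw [← hn]
      refine ncard_lt_ncard ⟨fun τ hτ => ⟨hτ.1, fun hτD => hτ.2 (hτD.trans subset_union_left)⟩,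
        fun hcon => ?_⟩ hfin'
      exact (hcon (⟨hκ, hκD⟩ : κ ∈ {κ ∈ cells | ¬ c κ ⊆ D})).2 subset_union_right
    · rintro z (hz | hz)
      · obtain ⟨h1, h2, h3⟩ := hDc z hz
        exact ⟨h1, h2, h3.trans subset_union_left⟩
      · obtain ⟨h1, h2, h3, -⟩ := hsig κ hκ z hz
        exact ⟨h1, h2, h3.trans subset_union_right⟩

end Lifting

/-! ### Retraction of a cylinder onto its bottom and sides -/

section Cubes

/-- The union of the bottom and the sides of the cylinder over a cube. -/
def cubeJar (N : Type*) : Set ((N → I) × I) := {z | z.1 ∈ Cube.boundary N ∨ z.2 = 0}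

variable {N : Type*} [Fintype N]

theorem isClosed_boundary : IsClosed (Cube.boundary N) := by
  have : Cube.boundary N = ⋃ i, {y : N → I | y i = 0 ∨ y i = 1} := by
    ext y; simp [Cube.boundary]
  rw [this]
  exact isClosed_iUnion_of_finite fun i =>
    (isClosed_eq (by fun_prop) (by fun_prop)).union (isClosed_eq (by fun_prop) (by fun_prop))

theorem isClosed_cubeJar : IsClosed (cubeJar N) :=
  (isClosed_boundary.preimage continuous_fst).union (isClosed_eq (by fun_prop) (by fun_prop))

omit [Fintype N] in
theorem boundary_eq_preimage_of_equiv {M : Type*} (e : M ≃ N) :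
    Cube.boundary M = (Homeomorph.piCongrLeft (Y := fun _ : N => I) e) ⁻¹' Cube.boundary N := by
  ext y
  simp only [Cube.boundary, mem_ofPred_eq, mem_preimage]
  constructor
  · rintro ⟨i, hi⟩
    exact ⟨e i, by simpa using hi⟩
  · rintro ⟨i, hi⟩
    obtain ⟨j, rfl⟩ := e.surjective i
    exact ⟨j, by simpa using hi⟩

/-- The homeomorphism splitting off the first coordinate of a cube. -/
def cubeSucc (n : ℕ) : (Fin (n + 1) → I) ≃ₜ (Fin n → I) × I where
  toFun u := (Fin.tail u, u 0)
  invFun z := Fin.cons z.2 z.1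
  left_inv u := Fin.cons_self_tail u
  right_inv z := by simp
  continuous_toFun := by unfold Fin.tail; fun_prop
  continuous_invFun := by fun_prop

/-- The scaling factor of the radial projection onto the bottom and the sides of the cylinder. -/
noncomputable def jarScale (z : (N → I) × I) : ℝ :=
  max ‖fun i => 2 * (z.1 i : ℝ) - 1‖ (1 - z.2 / 2)

/-- Radial projection of the cylinder over a cube onto its bottom and sides. -/
noncomputable def jarRetraction (z : (N → I) × I) : (N → I) × I :=
  (fun i => projIcc 0 1 zero_le_one ((1 + (2 * (z.1 i : ℝ) - 1) / jarScale z) / 2),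
    projIcc 0 1 zero_le_one (2 - (2 - z.2) / jarScale z))

theorem half_le_jarScale (z : (N → I) × I) : 1 / 2 ≤ jarScale z :=
  le_max_of_le_right (by linarith [z.2.2.2])

theorem continuous_jarScale : Continuous (jarScale (N := N)) := by
  unfold jarScale; fun_prop

theorem continuous_jarRetraction : Continuous (jarRetraction (N := N)) := by
  have := continuous_jarScale (N := N)
  have h0 : ∀ z : (N → I) × I, jarScale z ≠ 0 := fun z => by linarith [half_le_jarScale z]
  unfold jarRetraction
  refine Continuous.prodMk (continuous_pi fun i => continuous_projIcc.comp ?_)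
    (continuous_projIcc.comp ?_) <;> fun_prop (disch := exact h0 _)

theorem norm_two_mul_sub_one_le (u : N → I) : ‖fun i => 2 * (u i : ℝ) - 1‖ ≤ 1 := by
  refine (pi_norm_le_iff_of_nonneg zero_le_one).2 fun i => ?_
  rw [Real.norm_eq_abs, abs_le]
  constructor <;> linarith [(u i).2.1, (u i).2.2]

/-- The projection is from the point at height 2 above the centre of the cube. Which term attains
the maximum in `jarScale` decides whether the ray leaves through the bottom or through a side; in
the latter case the coordinate of largest modulus becomes 0 or 1. -/
theorem jarRetraction_mem (z : (N → I) × I) : jarRetraction z ∈ cubeJar N := by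
  have hpos := half_le_jarScale z
  rcases le_total ‖fun i => 2 * (z.1 i : ℝ) - 1‖ (1 - z.2 / 2) with h | h
  · right
    have : jarScale z = 1 - z.2 / 2 := max_eq_right h
    simp only [jarRetraction]
    rw [projIcc_of_le_left]
    · rfl
    · rw [this, sub_nonpos, le_div_iff₀ (by rw [this] at hpos; linarith)]
      linarith
  · left
    have hs : jarScale z = ‖fun i => 2 * (z.1 i : ℝ) - 1‖ := max_eq_left h
    have hne : Nonempty N := by
      by_contra hcon
      rw [not_nonempty_iff] at hcon
      have : ‖fun i => 2 * (z.1 i : ℝ) - 1‖ = 0 := by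
        rw [norm_eq_zero]; exact Subsingleton.elim _ _
      linarith
    obtain ⟨i, hi⟩ := Finite.exists_max fun i => ‖2 * (z.1 i : ℝ) - 1‖
    have hi' : jarScale z = |2 * (z.1 i : ℝ) - 1| := by
      rw [hs]
      refine le_antisymm ((pi_norm_le_iff_of_nonneg (abs_nonneg _)).2 hi) ?_
      exact norm_le_pi_norm (fun i => 2 * (z.1 i : ℝ) - 1) i
    refine ⟨i, ?_⟩
    simp only [jarRetraction]
    rcases abs_cases (2 * (z.1 i : ℝ) - 1) with ⟨h1, h2⟩ | ⟨h1, h2⟩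
    · right
      rw [projIcc_of_right_le]
      · rfl
      · rw [hi', h1, div_self (by linarith)]; norm_num
    · left
      rw [projIcc_of_le_left]
      · rfl
      · rw [hi', h1, div_neg, div_self (by linarith)]; norm_num

theorem jarRetraction_eq {z : (N → I) × I} (hz : z ∈ cubeJar N) : jarRetraction z = z := by
  have h1 : jarScale z = 1 := by
    apply le_antisymm
    · exact max_le (norm_two_mul_sub_one_le _) (by linarith [z.2.2.1])
    · rcases hz with ⟨i, hi⟩ | hz
      · refine le_max_of_le_left ?_
        refine le_trans ?_ (norm_le_pi_norm (fun i => 2 * (z.1 i : ℝ) - 1) i)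
        rcases hi with hi | hi <;> (simp [hi]; try norm_num)
      · exact le_max_of_le_right (by simp [hz])
  ext i
  · simp only [jarRetraction, h1]
    rw [show (1 + (2 * (z.1 i : ℝ) - 1) / 1) / 2 = z.1 i by ring, projIcc_val]
  · simp only [jarRetraction, h1]
    rw [show (2 - (2 - (z.2 : ℝ)) / 1) = z.2 by ring, projIcc_val]

end Cubes

/-! ### Relative lifting for Serre fibrations -/

section Serre

variable {X Y : Type*} [TopologicalSpace X] [TopologicalSpace Y] {f : X → Y}

/-- A Serre fibration has the relative lifting property for every retract of a cube. -/
theorem IsSerreFibration.liftsOn_of_retract (hf : IsSerreFibration f) {k : ℕ}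
    {A : Set (Fin k → I)} {r : (Fin k → I) → (Fin k → I)} (hr : Continuous r)
    (hrA : ∀ u, r u ∈ A) (hrr : ∀ u ∈ A, r u = u) {h : (Fin k → I) → Y} (hh : Continuous h) :
    LiftsOn f h A univ := by
  intro g hg hfg
  -- A homotopy starting at r that moves each coordinate of r u towards that of u with unit speed
  -- and then stops. It has reached u by time dist u (r u), which vanishes on A. Evaluating the
  -- lifted homotopy at that time therefore returns g on A exactly.
  let K : (Fin k → I) × I → Fin k → I := fun z i => projIcc 0 1 zero_le_one
    ((r z.1 i : ℝ) + max (-(z.2 : ℝ)) (min (z.2 : ℝ) ((z.1 i : ℝ) - r z.1 i)))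
  have hK : Continuous K := continuous_pi fun i => continuous_projIcc.comp (by fun_prop)
  have hK0 : ∀ u, K (u, 0) = r u := by
    intro u
    funext i
    simp only [K, Icc.coe_zero, neg_zero]
    rw [max_eq_left (min_le_left _ _), add_zero, projIcc_val]
  have hgr : Continuous (g ∘ r) :=
    hg.comp_continuous hr hrA
  obtain ⟨L, hL0, hL⟩ := hf.2 k ⟨h ∘ K, hh.comp hK⟩ ⟨g ∘ r, hgr⟩ fun u => by
    simp [hK0, hfg _ (hrA u)]
  have hd : ∀ u, dist u (r u) ≤ 1 := fun u => (dist_pi_le_iff zero_le_one).2 fun i => by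
    rw [Subtype.dist_eq, Real.dist_eq, abs_le]
    constructor <;> linarith [(u i).2.1, (u i).2.2, (r u i).2.1, (r u i).2.2]
  let φ : (Fin k → I) → I := fun u => ⟨dist u (r u), dist_nonneg, hd u⟩
  have hφ : Continuous φ := by
    refine Continuous.subtype_mk (by fun_prop) _
  have hKφ : ∀ u, K (u, φ u) = u := by
    intro u
    funext i
    have : |(u i : ℝ) - r u i| ≤ dist u (r u) := dist_le_pi_dist u (r u) i
    rw [abs_le] at this
    simp only [K, φ]
    rw [min_eq_right this.2, max_eq_right this.1, add_sub_cancel, projIcc_val]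
  refine ⟨fun u => L (u, φ u), by fun_prop, fun u hu => ?_, fun u _ => ?_⟩
  · have : φ u = 0 := Subtype.ext (by simp [φ, hrr u hu])
    simp only [this, hL0]
    simp [hrr u hu]
  · rw [hL]
    simp [hKφ]

theorem IsSerreFibration.liftsOn_cubeJar (hf : IsSerreFibration f) {n : ℕ}
    {h : (Fin n → I) × I → Y} (hh : Continuous h) : LiftsOn f h (cubeJar (Fin n)) univ := by
  refine LiftsOn.of_homeomorph (cubeSucc n) ?_
  refine hf.liftsOn_of_retract (r := (cubeSucc n).symm ∘ jarRetraction ∘ cubeSucc n) ?_ ?_ ?_ (hh.comp (cubeSucc n).continuous)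
  · exact (cubeSucc n).symm.continuous.comp (continuous_jarRetraction.comp (cubeSucc n).continuous)
  · intro u
    simpa using jarRetraction_mem _
  · intro u hu
    simp [jarRetraction_eq hu]

end Serre

/-! ### Cube lifting and homotopy extension -/

section Extension

variable {E B : Type*} [TopologicalSpace E]

/-- A map with the right lifting property for all pairs `(I^n, ∂I^n)`. -/
def IsCubeLifting [TopologicalSpace B] (q : E → B) : Prop :=
  Function.Surjective q ∧ ∀ (n : ℕ) (h : (Fin n → I) → B), Continuous h →
    LiftsOn q h (Cube.boundary (Fin n)) univ

variable {N : Type*} [Fintype N]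

/-- The working form of lifting over a cylinder: a prescribes the bottom and b the sides. -/
theorem LiftsOn.exists_lift_cubeJar {q : E → B} {H : (N → I) × I → B}
    (hL : LiftsOn q H (cubeJar N) univ) {a : (N → I) → E} (ha : Continuous a)
    (haH : ∀ u, q (a u) = H (u, 0)) {b : (N → I) × I → E}
    (hb : ContinuousOn b {z | z.1 ∈ Cube.boundary N})
    (hbH : ∀ u ∈ Cube.boundary N, ∀ t, q (b (u, t)) = H (u, t))
    (hab : ∀ u ∈ Cube.boundary N, b (u, 0) = a u) :
    ∃ L : (N → I) × I → E, Continuous L ∧ (∀ u, L (u, 0) = a u) ∧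
      (∀ u ∈ Cube.boundary N, ∀ t, L (u, t) = b (u, t)) ∧ ∀ z, q (L z) = H z := by
  classical
  let g : (N → I) × I → E := fun z => if z.1 ∈ Cube.boundary N then b z else a z.1
  have hg0 : ∀ u, g (u, 0) = a u := fun u => by
    by_cases hu : u ∈ Cube.boundary N
    · simp [g, hu, hab u hu]
    · simp [g, hu]
  have hg1 : EqOn g b {z | z.1 ∈ Cube.boundary N} := fun z (hz : z.1 ∈ Cube.boundary N) => by simp [g, hz]
  have hcl : IsClosed {z : (N → I) × I | z.2 = 0} := isClosed_eq continuous_snd continuous_const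
  have hg : ContinuousOn g (cubeJar N) := by
    refine (hb.congr hg1).union_of_isClosed (t := {z | z.2 = 0})
      ((ha.comp continuous_fst).continuousOn.congr ?_)
      (isClosed_boundary.preimage continuous_fst) hcl
    rintro ⟨u, t⟩ (rfl : t = 0)
    exact hg0 u
  obtain ⟨L, hLc, hLg, hLq⟩ := hL g hg (by
    rintro ⟨u, t⟩ hz
    by_cases hu : u ∈ Cube.boundary N
    · rw [hg1 hu, hbH u hu]
    · obtain rfl : t = 0 := hz.resolve_left hu
      rw [hg0, haH])
  exact ⟨L, continuousOn_univ.1 hLc, fun u => (hLg (Or.inr rfl)).trans (hg0 u),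
    fun u hu t => (hLg (Or.inl hu)).trans (hg1 hu), fun z => hLq z trivial⟩

/-- Homotopy extension is lifting through the map to a point, where the retraction of the cylinder
solves the problem. -/
theorem exists_homotopy_extension {a : (N → I) → E} (ha : Continuous a)
    {b : (N → I) × I → E} (hb : ContinuousOn b {z | z.1 ∈ Cube.boundary N})
    (hab : ∀ u ∈ Cube.boundary N, b (u, 0) = a u) :
    ∃ L : (N → I) × I → E, Continuous L ∧ (∀ u, L (u, 0) = a u) ∧
      (∀ u ∈ Cube.boundary N, ∀ t, L (u, t) = b (u, t)) := by
  have hL : LiftsOn (fun _ : E => ()) (fun _ => ()) (cubeJar N) univ := fun g hg _ =>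
    ⟨g ∘ jarRetraction, (hg.comp_continuous continuous_jarRetraction
      jarRetraction_mem).continuousOn, fun z hz => by simp [jarRetraction_eq hz], fun _ _ => rfl⟩
  obtain ⟨L, h1, h2, h3, -⟩ := hL.exists_lift_cubeJar ha (fun _ => rfl) hb (fun _ _ _ => rfl) hab
  exact ⟨L, h1, h2, h3⟩

/-- Extendability to the cube of a map on its boundary is invariant under homotopy. -/
theorem exists_extension_of_homotopy {a : (N → I) → E} (ha : Continuous a)
    {b : (N → I) × I → E} (hb : ContinuousOn b {z | z.1 ∈ Cube.boundary N})
    (hab : ∀ u ∈ Cube.boundary N, b (u, 1) = a u) :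
    ∃ a' : (N → I) → E, Continuous a' ∧ ∀ u ∈ Cube.boundary N, a' u = b (u, 0) := by
  obtain ⟨L, h1, -, h3⟩ := exists_homotopy_extension ha (b := fun z => b (z.1, σ z.2))
    (hb.comp (by fun_prop) fun z hz => hz) (by simpa using hab)
  exact ⟨fun u => L (u, 1), by fun_prop, fun u hu => by simpa using h3 u hu 1⟩

/-- The linear contraction of a cube to a vertex. -/
def cubeContract (u : N → I) (t : I) : N → I := fun i => σ t * u i

omit [Fintype N] in
theorem continuous_cubeContract : Continuous fun z : (N → I) × I => cubeContract z.1 z.2 := by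
  unfold cubeContract; fun_prop

omit [Fintype N] in
@[simp] theorem cubeContract_zero (u : N → I) : cubeContract u 0 = u := by
  funext i; simp [cubeContract]

omit [Fintype N] in
@[simp] theorem cubeContract_one (u : N → I) : cubeContract u 1 = fun _ => 0 := by
  funext i; simp [cubeContract]

theorem mem_boundary_succ {n : ℕ} {u : Fin (n + 1) → I} :
    u ∈ Cube.boundary (Fin (n + 1)) ↔ cubeSucc n u ∈ cubeJar (Fin n) ∨ u 0 = 1 := by
  simp only [Cube.boundary, cubeJar, cubeSucc, mem_ofPred_eq, Fin.exists_fin_succ]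
  change _ ↔ ((∃ i : Fin n, u i.succ = 0 ∨ u i.succ = 1) ∨ u 0 = 0) ∨ u 0 = 1
  grind

end Extension

/-! ### Acyclic Serre fibrations have the cube lifting property -/

section WeakEquiv

variable {X Y : Type*} [TopologicalSpace X] [TopologicalSpace Y] {f : X → Y}

/-- Injectivity on π_k, with k = 0 included: there a generalized loop is a point, a homotopy is a
path, and injectivity on path components applies. -/
theorem IsWeakHomotopyEquiv.homotopic_of_map (hc : Continuous f) (hf : IsWeakHomotopyEquiv f)
    {k : ℕ} {x : X} {γ γ' : GenLoop (Fin k) X x}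
    (H : GenLoop.Homotopic (genLoopMap ⟨f, hc⟩ k x γ) (genLoopMap ⟨f, hc⟩ k x γ')) :
    GenLoop.Homotopic γ γ' := by
  obtain ⟨hc', h0, hpi⟩ := hf
  rcases Nat.eq_zero_or_pos k with rfl | hk
  · obtain ⟨F⟩ := H
    have hj : Joined (f (γ default)) (f (γ' default)) :=
      ⟨⟨⟨fun t => F (t, default), by fun_prop⟩, F.apply_zero default, F.apply_one default⟩⟩
    have : Joined (γ default) (γ' default) := by
      apply Quotient.exact (s := pathSetoid X)
      exact h0.1 (Quotient.sound hj)
    obtain ⟨p⟩ := this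
    refine ⟨⟨⟨⟨fun z => p z.1, by fun_prop⟩, fun u => ?_, fun u => ?_⟩, ?_⟩⟩
    · rw [Subsingleton.elim u default]; simp
    · rw [Subsingleton.elim u default]; simp
    · rintro t u ⟨i, -⟩
      exact i.elim0
  · apply Quotient.exact (s := GenLoop.Homotopic.setoid (Fin k) x)
    exact (hpi k x hk).1 (Quotient.sound H)

theorem IsWeakHomotopyEquiv.exists_genLoop (hc : Continuous f) (hf : IsWeakHomotopyEquiv f)
    {k : ℕ} (hk : 1 ≤ k) {x : X} (β : GenLoop (Fin k) Y (f x)) :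
    ∃ α : GenLoop (Fin k) X x, GenLoop.Homotopic (genLoopMap ⟨f, hc⟩ k x α) β := by
  obtain ⟨hc', h0, hpi⟩ := hf
  obtain ⟨a, ha⟩ := (hpi k x hk).2 (Quotient.mk (GenLoop.Homotopic.setoid (Fin k) (f x)) β)
  induction a using Quotient.inductionOn with
  | _ α => exact ⟨α, Quotient.exact (s := GenLoop.Homotopic.setoid (Fin k) (f x)) ha⟩

/-- Every y is joined by a path to a point of the image, and the path lifts. -/
theorem IsWeakHomotopyEquiv.surjective (hf : IsWeakHomotopyEquiv f) (hs : IsSerreFibration f) :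
    Function.Surjective f := by
  intro y
  obtain ⟨hc, h0, -⟩ := hf
  obtain ⟨x, hx⟩ := h0.2 (Quotient.mk (pathSetoid Y) y)
  induction x using Quotient.inductionOn with
  | _ x =>
  obtain ⟨p⟩ : Joined (f x) y := Quotient.exact (s := pathSetoid Y) hx
  obtain ⟨L, -, hL⟩ := hs.2 0 ⟨fun z => p z.2, by fun_prop⟩ ⟨fun _ => x, by fun_prop⟩ (by simp)
  exact ⟨L (default, 1), by simp [hL]⟩

/-- A weak equivalence is injective on free homotopy classes of spheres that bound. -/
theorem IsWeakHomotopyEquiv.exists_extension (hf : IsWeakHomotopyEquiv f) {k : ℕ}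
    {g : (Fin (k + 1) → I) → X} (hg : ContinuousOn g (Cube.boundary (Fin (k + 1))))
    {h : (Fin (k + 1) → I) → Y} (hh : Continuous h)
    (hgh : ∀ u ∈ Cube.boundary (Fin (k + 1)), f (g u) = h u) :
    ∃ Γ : (Fin (k + 1) → I) → X, Continuous Γ ∧ ∀ u ∈ Cube.boundary (Fin (k + 1)), Γ u = g u := by
  classical
  have hc : Continuous f := hf.1
  let e := cubeSucc k
  have hjar : ∀ z ∈ cubeJar (Fin k), e.symm z ∈ Cube.boundary (Fin (k + 1)) := fun z hz =>
    mem_boundary_succ.2 (Or.inl (by simpa [e] using hz))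
  have htop : ∀ u : Fin k → I, e.symm (u, 1) ∈ Cube.boundary (Fin (k + 1)) := fun u =>
    mem_boundary_succ.2 (Or.inr rfl)
  -- The boundary sphere is a contractible jar together with a top face. Extending g from the jar to
  -- the whole cube and contracting the cube to a vertex deforms g on the jar to the constant x₀.
  let G₀ : (Fin (k + 1) → I) → X := fun u => g (e.symm (jarRetraction (e u)))
  have hG₀ : Continuous G₀ := hg.comp_continuous
    (e.symm.continuous.comp (continuous_jarRetraction.comp e.continuous))
    fun u => hjar _ (jarRetraction_mem _)
  have hG₀g : ∀ u, e u ∈ cubeJar (Fin k) → G₀ u = g u := fun u hu => by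
    simp [G₀, jarRetraction_eq hu]
  let x₀ : X := G₀ fun _ => 0
  -- The contraction extended over the top face. At time 1 the whole sphere map is carried by the
  -- top, as a loop γ at x₀.
  obtain ⟨F, hFc, hF0, hFb⟩ := exists_homotopy_extension (a := fun u => g (e.symm (u, 1)))
    (hg.comp_continuous (by fun_prop) htop)
    (b := fun z => G₀ (cubeContract (e.symm (z.1, 1)) z.2))
    (hG₀.comp (continuous_cubeContract.comp (f := fun z : (Fin k → I) × I =>
      (e.symm (z.1, 1), z.2)) (by fun_prop))).continuousOn
    (fun u hu => by simpa using hG₀g _ (show (_ : (Fin k → I) × I) ∈ cubeJar (Fin k) from Or.inl (by simpa using hu)))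
  let b : (Fin (k + 1) → I) × I → X := fun z =>
    if e z.1 ∈ cubeJar (Fin k) then G₀ (cubeContract z.1 z.2) else F ((e z.1).1, z.2)
  have hb1 : EqOn b (fun z => G₀ (cubeContract z.1 z.2)) {z | e z.1 ∈ cubeJar (Fin k)} :=
    fun z (hz : e z.1 ∈ cubeJar (Fin k)) => by simp [b, hz]
  have hb2 : EqOn b (fun z => F ((e z.1).1, z.2)) {z | z.1 0 = 1} := by
    rintro ⟨u, t⟩ (hu : u 0 = 1)
    by_cases huj : e u ∈ cubeJar (Fin k)
    · have h1 : (e u).1 ∈ Cube.boundary (Fin k) := huj.resolve_right (by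
        change u 0 ≠ 0
        rw [hu]; exact one_ne_zero)
      have h2 : e.symm ((e u).1, 1) = u := by
        rw [← hu]; exact e.symm_apply_apply u
      rw [hb1 huj]
      change _ = F ((e u).1, t)
      rw [hFb _ h1, h2]
    · simp [b, huj]
  have hbc : ContinuousOn b {z | z.1 ∈ Cube.boundary (Fin (k + 1))} := by
    have : {z : (Fin (k + 1) → I) × I | z.1 ∈ Cube.boundary (Fin (k + 1))} =
        {z | e z.1 ∈ cubeJar (Fin k)} ∪ {z | z.1 0 = 1} := by
      ext z; exact mem_boundary_succ
    rw [this]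
    exact ((hG₀.comp continuous_cubeContract).continuousOn.congr hb1).union_of_isClosed
      (Continuous.continuousOn (by fun_prop) |>.congr hb2)
      (isClosed_cubeJar.preimage (by fun_prop)) (isClosed_eq (by fun_prop) (by fun_prop))
  have hb0 : ∀ u ∈ Cube.boundary (Fin (k + 1)), b (u, 0) = g u := by
    intro u hu
    rcases mem_boundary_succ.1 hu with hu | hu
    · rw [hb1 hu]; simpa using hG₀g u hu
    · rw [hb2 hu]
      change F ((e u).1, 0) = g u
      rw [hF0, ← hu]
      exact congrArg g (e.symm_apply_apply u)
  have hγ : ∀ u ∈ Cube.boundary (Fin k), F (u, 1) = x₀ := fun u hu => by simp [hFb u hu, x₀]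
  let γ : GenLoop (Fin k) X x₀ := ⟨⟨fun u => F (u, 1), by fun_prop⟩, hγ⟩
  -- The filling h of f ∘ g is carried along the homotopy f ∘ b. At time 1 it fills f ∘ γ and is
  -- constant on the jar, so its slices in the coordinate u 0 form a nullhomotopy of f ∘ γ through
  -- loops.
  obtain ⟨H, hHc, hH0, hHb⟩ := exists_homotopy_extension hh (b := fun z => f (b z))
    (hc.comp_continuousOn hbc) fun u hu => by rw [hb0 u hu, hgh u hu]
  have hH1 : ∀ z ∈ cubeJar (Fin k), H (e.symm z, 1) = f x₀ := fun z hz => by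
    have hz' : e (e.symm z) ∈ cubeJar (Fin k) := by simpa using hz
    rw [hHb _ (hjar z hz), hb1 hz']
    simp [x₀]
  have hγh : GenLoop.Homotopic (genLoopMap ⟨f, hc⟩ k x₀ GenLoop.const)
      (genLoopMap ⟨f, hc⟩ k x₀ γ) := by
    refine ⟨⟨⟨⟨fun z => H (e.symm (z.2, z.1), 1), by fun_prop⟩, fun u => ?_, fun u => ?_⟩, ?_⟩⟩
    · exact hH1 _ (Or.inr rfl)
    · change H (e.symm (u, 1), 1) = f (F (u, 1))
      rw [hHb _ (htop u), hb2 rfl]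
      simp
    · intro t u hu
      exact hH1 _ (Or.inl hu)
  -- Injectivity of f on π_k contracts γ itself. Read as a map on the cube, the contraction fills
  -- the deformed sphere, and running b backwards yields a filling of g.
  obtain ⟨Θ⟩ := hf.homotopic_of_map hc hγh
  obtain ⟨Γ, h1, h2⟩ := exists_extension_of_homotopy (a := fun u => Θ ((e u).2, (e u).1))
    (by fun_prop) hbc (by
    intro u hu
    rcases mem_boundary_succ.1 hu with hu | hu
    · rw [hb1 hu]
      simp only [cubeContract_one]
      rcases hu with hu | hu
      · rw [Θ.eq_fst _ hu]; rfl
      · rw [show (e u).2 = 0 from hu, Θ.apply_zero]; rfl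
    · rw [hb2 hu, show (e u).2 = 1 from hu, Θ.apply_one]; rfl)
  exact ⟨Γ, h1, fun u hu => by rw [h2 u hu, hb0 u hu]⟩

/-- An acyclic Serre fibration has the right lifting property for all pairs `(I^n, ∂I^n)`. -/
theorem IsSerreFibration.isCubeLifting (hs : IsSerreFibration f) (hf : IsWeakHomotopyEquiv f) :
    IsCubeLifting f := by
  have hc : Continuous f := hs.1
  refine ⟨hf.surjective hs, fun n h hh g hg hgh => ?_⟩
  rcases n with _ | k
  · obtain ⟨x, hx⟩ := hf.surjective hs (h default)
    refine ⟨fun _ => x, continuousOn_const, ?_, fun u _ => by rw [hx, Subsingleton.elim u default]⟩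
    rintro u ⟨i, -⟩
    exact i.elim0
  -- Γ extends g but need not lift h. The discrepancy is the class β obtained from h by contracting
  -- the boundary values along f ∘ Γ; surjectivity on π_{k+1} removes it.
  obtain ⟨Γ, hΓ, hΓg⟩ := hf.exists_extension hg hh hgh
  let x₀ : X := Γ fun _ => 0
  have hbc : Continuous fun z : (Fin (k + 1) → I) × I => Γ (cubeContract z.1 z.2) :=
    hΓ.comp continuous_cubeContract
  obtain ⟨H, hHc, hH0, hHb⟩ := exists_homotopy_extension hh (hc.comp hbc).continuousOn
    fun u hu => by simp [hΓg u hu, hgh u hu]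
  simp only [Function.comp_apply] at hHb
  let β : GenLoop (Fin (k + 1)) Y (f x₀) :=
    ⟨⟨fun u => H (u, 1), by fun_prop⟩, fun u hu => by
      change H (u, 1) = _
      simp [hHb u hu, x₀]⟩
  obtain ⟨α, ⟨Θ⟩⟩ := hf.exists_genLoop hc (Nat.le_add_left 1 k) β
  -- Lifting the homotopy from f ∘ α to β, constantly on the boundary, replaces the homotopy lift α
  -- by a strict lift of β.
  obtain ⟨L₁, hL₁, h10, h1b, h1⟩ :=
    (hs.liftsOn_cubeJar (h := fun z => Θ (z.2, z.1)) (by fun_prop)).exists_lift_cubeJar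
      (a := α) α.1.continuous (fun u => (Θ.apply_zero u).symm) (b := fun _ => x₀) continuousOn_const
      (fun u hu t => by
        rw [Θ.eq_fst t hu]
        exact congrArg f (α.2 u hu).symm)
      (fun u hu => (α.2 u hu).symm)
  -- Lifting H backwards leads from this lift of β to a lift of h; the sides follow the reversed
  -- contraction of Γ and so end at g.
  obtain ⟨L₂, hL₂, h20, h2b, h2⟩ :=
    (hs.liftsOn_cubeJar (h := fun z => H (z.1, σ z.2)) (by fun_prop)).exists_lift_cubeJar
      (a := fun u => L₁ (u, 1)) (by fun_prop) (fun u => by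
        rw [h1]
        exact (Θ.apply_one u).trans (by rw [unitInterval.symm_zero]; rfl))
      (b := fun z => Γ (cubeContract z.1 (σ z.2))) (Continuous.continuousOn
        (hbc.comp (f := fun z : (Fin (k + 1) → I) × I => (z.1, σ z.2)) (by fun_prop)))
      (fun u hu t => (hHb u hu _).symm) (fun u hu => by simp [h1b u hu, x₀])
  refine ⟨fun u => L₂ (u, 1), Continuous.continuousOn (by fun_prop), fun u hu => ?_, fun u _ => ?_⟩
  · simp [h2b u hu, hΓg u hu]
  · simp [h2, hH0]

end WeakEquiv

/-! ### Pullback corner maps and the exponential law -/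

section Corner

variable {E B Z M : Type*} [TopologicalSpace E] [TopologicalSpace B] [TopologicalSpace Z]
  [TopologicalSpace M]

theorem IsCubeLifting.liftsOn_cube {q : E → B} (hq : IsCubeLifting q) {N : Type*} [Fintype N]
    {h : (N → I) → B} (hh : Continuous h) : LiftsOn q h (Cube.boundary N) univ := by
  let e := (Fintype.equivFin N).symm
  refine LiftsOn.of_homeomorph (Homeomorph.piCongrLeft (Y := fun _ : N => I) e) ?_
  rw [← boundary_eq_preimage_of_equiv]
  exact hq.2 _ _ (hh.comp (Homeomorph.continuous _))

/-- The target of the pullback corner map of `q` and the inclusion of `N` in `M`. -/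
abbrev Corner (q : C(E, B)) (N : Set M) : Type _ :=
  {p : C(N, E) × C(M, B) // ∀ x : N, q (p.1 x) = p.2 x}

/-- The pullback corner map (Leibniz exponential) of `q` and the inclusion of `N` in `M`. -/
def cornerMap (q : C(E, B)) (N : Set M) (γ : C(M, E)) : Corner q N :=
  ⟨(γ.restrict N, q.comp γ), fun _ => rfl⟩

theorem continuous_cornerMap (q : C(E, B)) (N : Set M) : Continuous (cornerMap q N) := by
  refine Continuous.subtype_mk (Continuous.prodMk ?_ ?_) _
  · exact ContinuousMap.continuous_restrict N
  · exact q.continuous_postcomp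

variable [CompactSpace M] [T2Space M]

/-- Adjunction: a lift through the corner map over Z is a lift through q over Z × M. Compactness of
M, and hence of its closed subset N, makes evaluation continuous. -/
theorem LiftsOn.cornerMap {q : C(E, B)} {N : Set M} (hN : IsClosed N) {A : Set Z} (hA : IsClosed A)
    (H : ∀ h : Z × M → B, Continuous h → LiftsOn q h ({z | z.1 ∈ A} ∪ {z | z.2 ∈ N}) univ)
    {h : Z → Corner q N} (hh : Continuous h) : LiftsOn (cornerMap q N) h A univ := by
  classical
  intro g hg hgh
  have : CompactSpace N := isCompact_iff_compactSpace.1 hN.isCompact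
  have hval : Continuous fun z => (h z).1 := continuous_subtype_val.comp hh
  let G : Z × M → E := fun z =>
    if z.1 ∈ A then g z.1 z.2 else if hx : z.2 ∈ N then (h z.1).1.1 ⟨z.2, hx⟩ else g z.1 z.2
  have hGA : EqOn G (fun z => g z.1 z.2) {z | z.1 ∈ A} :=
    fun z (hz : z.1 ∈ A) => by simp [G, hz]
  have hGN : ∀ z (hx : z.2 ∈ N), G z = (h z.1).1.1 ⟨z.2, hx⟩ := fun z hx => by
    by_cases hz : z.1 ∈ A
    · rw [hGA hz, ← hgh _ hz]; rfl
    · simp [G, hz, hx]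
  have hG : ContinuousOn G ({z | z.1 ∈ A} ∪ {z | z.2 ∈ N}) := by
    refine ContinuousOn.union_of_isClosed ?_ ?_ (hA.preimage continuous_fst)
      (hN.preimage continuous_snd)
    · refine ContinuousOn.congr ?_ hGA
      have hg' : ContinuousOn (fun z : Z × M => g z.1) {z | z.1 ∈ A} :=
        hg.comp continuous_fst.continuousOn fun z hz => hz
      exact hg'.eval continuous_snd.continuousOn
    · rw [continuousOn_iff_continuous_domRestrict]
      have : Continuous fun z : {z : Z × M | z.2 ∈ N} => (h z.1.1).1.1 ⟨z.1.2, z.2⟩ :=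
        (continuous_fst.comp (hval.comp (by fun_prop))).eval (by fun_prop)
      exact this.congr fun z => (hGN z.1 z.2).symm
  obtain ⟨L, hL, hLG, hLq⟩ := H (fun z => (h z.1).1.2 z.2)
    ((continuous_snd.comp (hval.comp continuous_fst)).eval continuous_snd) G hG (by
      rintro ⟨z, x⟩ hz
      by_cases hzA : z ∈ A
      · rw [hGA hzA]
        change q (g z x) = (h z).1.2 x
        rw [← hgh z hzA]; rfl
      · have hx : x ∈ N := hz.resolve_left hzA
        rw [hGN _ hx, (h z).2])
  have hLc : Continuous L := continuousOn_univ.1 hL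
  refine ⟨fun z => (ContinuousMap.curry ⟨L, hLc⟩) z, (map_continuous _).continuousOn, fun z hz => ?_,
    fun z _ => ?_⟩
  · ext x
    exact (hLG (Or.inl hz)).trans (hGA hz)
  · refine Subtype.ext (Prod.ext ?_ ?_)
    · ext x
      exact (hLG (Or.inr x.2)).trans (hGN (z, x) x.2)
    · ext x
      exact hLq (z, x) trivial

/-- The adjunction read in the other direction. -/
theorem LiftsOn.of_cornerMap [Nonempty M] {q : C(E, B)} {N : Set M} {A : Set Z}
    (H : ∀ h : Z → Corner q N, Continuous h → LiftsOn (_root_.cornerMap q N) h A univ)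
    {h : Z × M → B} (hh : Continuous h) :
    LiftsOn q h ({z | z.1 ∈ A} ∪ {z | z.2 ∈ N}) univ := by
  classical
  intro g hg hgh
  let F : C(Z, C(N, E)) := ContinuousMap.curry ⟨fun z => g (z.1, z.2),
    hg.comp_continuous (by fun_prop) fun z => Or.inr z.2.2⟩
  let FA : C(A, C(M, E)) := ContinuousMap.curry ⟨fun z => g (z.1, z.2),
    hg.comp_continuous (by fun_prop) fun z => Or.inl z.1.2⟩
  let h' : Z → Corner q N := fun z =>
    ⟨(F z, ContinuousMap.curry ⟨h, hh⟩ z), fun x => hgh (z, x) (Or.inr x.2)⟩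
  have hh' : Continuous h' :=
    Continuous.subtype_mk ((map_continuous F).prodMk (map_continuous _)) _
  -- Only the values on A matter; elsewhere a constant map serves, which is where a point of M is
  -- used.
  let G : Z → C(M, E) := fun z =>
    if hz : z ∈ A then FA ⟨z, hz⟩ else ContinuousMap.const M (g (z, Classical.arbitrary M))
  have hGA : ∀ z (hz : z ∈ A), G z = FA ⟨z, hz⟩ := fun z hz => by simp [G, hz]
  obtain ⟨L, hL, hLG, hLh⟩ := H h' hh' G (by
    rw [continuousOn_iff_continuous_domRestrict]
    exact (map_continuous FA).congr fun z => (hGA z.1 z.2).symm) (by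
    intro z hz
    rw [hGA z hz]
    refine Subtype.ext (Prod.ext ?_ ?_)
    · ext x; rfl
    · ext x
      exact hgh (z, x) (Or.inl hz))
  refine ⟨fun z => L z.1 z.2, Continuous.continuousOn ?_, ?_, ?_⟩
  · exact ((continuousOn_univ.1 hL).comp continuous_fst).eval continuous_snd
  · rintro ⟨z, x⟩ hz
    by_cases hzA : z ∈ A
    · change L z x = _
      rw [hLG hzA, hGA z hzA]; rfl
    · have hx : x ∈ N := hz.resolve_left hzA
      have := congrArg (fun p => p.1.1 ⟨x, hx⟩) (hLh z trivial)
      exact this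
  · rintro ⟨z, x⟩ -
    have := congrArg (fun p => p.1.2 x) (hLh z trivial)
    exact this

-- `LiftsOn` starts from a total map into E and is vacuous for empty E, so surjectivity needs the
-- separate input `hE`.
omit [CompactSpace M] [T2Space M] in
theorem cornerMap_surjective {q : C(E, B)} {N : Set M} (hE : Corner q N → Nonempty E)
    (H : ∀ h : M → B, Continuous h → LiftsOn q h N univ) :
    Function.Surjective (cornerMap q N) := by
  classical
  intro p
  obtain ⟨e₀⟩ := hE p
  let g : M → E := fun x => if hx : x ∈ N then p.1.1 ⟨x, hx⟩ else e₀
  have hg : ∀ x : N, g x = p.1.1 x := fun x => by simp [g]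
  obtain ⟨L, hL, hLg, hLq⟩ := H p.1.2 (map_continuous _) g (by
    rw [continuousOn_iff_continuous_domRestrict]
    exact (map_continuous p.1.1).congr fun x => (hg x).symm) fun x hx => by
      rw [hg ⟨x, hx⟩, p.2]
  refine ⟨⟨L, continuousOn_univ.1 hL⟩, Subtype.ext (Prod.ext ?_ ?_)⟩
  · ext x
    exact (hLg x.2).trans (hg x)
  · ext x
    exact hLq x trivial

/-- By adjunction, since ∂(Iⁿ × Iᵏ) = ∂Iⁿ × Iᵏ ∪ Iⁿ × ∂Iᵏ. -/
theorem IsCubeLifting.cornerMap_cube {q : C(E, B)} (hq : IsCubeLifting q) (k : ℕ) :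
    IsCubeLifting (cornerMap q (Cube.boundary (Fin k))) := by
  refine ⟨cornerMap_surjective (fun p => ?_) fun h hh => hq.liftsOn_cube hh,
    fun n h hh => LiftsOn.cornerMap isClosed_boundary isClosed_boundary (fun h hh => ?_) hh⟩
  · obtain ⟨e, -⟩ := hq.1 (p.1.2 fun _ => 0)
    exact ⟨e⟩
  · refine LiftsOn.of_homeomorph (Homeomorph.sumArrowHomeomorphProdArrow (ι := Fin n)
      (ι' := Fin k)) ?_
    have : (Homeomorph.sumArrowHomeomorphProdArrow (X := I) (ι := Fin n) (ι' := Fin k)) ⁻¹'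
        ({z | z.1 ∈ Cube.boundary (Fin n)} ∪ {z | z.2 ∈ Cube.boundary (Fin k)}) =
        Cube.boundary (Fin n ⊕ Fin k) := by
      ext y
      exact Cube.boundary_sum_iff.symm
    rw [this]
    exact hq.liftsOn_cube (hh.comp (Homeomorph.continuous _))

/-- By adjunction, lifting against ∂Iⁿ becomes lifting from the bottom and sides of a cylinder.
Results about cube lifting thereby yield relative homotopy lifting for Serre fibrations. -/
theorem IsSerreFibration.cornerMap_interval {q : C(E, B)} (hq : IsSerreFibration q) :
    IsCubeLifting (cornerMap q ({0} : Set I)) := by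
  refine ⟨cornerMap_surjective (fun p => ⟨p.1.1 ⟨0, rfl⟩⟩) fun h hh => ?_,
    fun n h hh => LiftsOn.cornerMap isClosed_singleton isClosed_boundary (fun h hh => ?_) hh⟩
  · have := hq.liftsOn_cubeJar (n := 0) (h := fun z => h z.2) (by fun_prop)
    refine LiftsOn.of_homeomorph (Homeomorph.uniqueProd (Fin 0 → I) I) ?_
    have hjar : Homeomorph.uniqueProd (Fin 0 → I) I ⁻¹' {0} = cubeJar (Fin 0) := by
      ext z
      refine ⟨Or.inr, ?_⟩
      rintro (⟨i, -⟩ | ht)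
      · exact i.elim0
      · exact ht
    rw [hjar]
    exact this
  · exact hq.liftsOn_cubeJar hh

end Corner

/-! ### Integral grids and extension of lifts in a box -/

section Grid

variable {E B : Type*} [TopologicalSpace E] [TopologicalSpace B] {ι : Type*} [Fintype ι]

/-- The points of the box with lower and upper vertices `p.1` and `p.2`. -/
def gridCell (p : (ι → ℤ) × (ι → ℤ)) : Set (ι → ℝ) := {x | ∀ i, (p.1 i : ℝ) ≤ x i ∧ x i ≤ p.2 i}

/-- The cells of the integral grid that are contained in the cube `[-n, n]^ι`. -/
def gridCells (ι : Type*) (n : ℕ) : Set ((ι → ℤ) × (ι → ℤ)) :=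
  {p | ∀ i, -(n : ℤ) ≤ p.1 i ∧ p.1 i ≤ p.2 i ∧ p.2 i ≤ p.1 i + 1 ∧ p.2 i ≤ n}

/-- The smallest cell of the integral grid containing `x`. -/
noncomputable def gridCarrier (x : ι → ℝ) : (ι → ℤ) × (ι → ℤ) :=
  (fun i => ⌊x i⌋, fun i => ⌈x i⌉)

theorem finite_gridCells (n : ℕ) : (gridCells ι n).Finite := by
  classical
  refine ((finite_Icc (fun _ : ι => -(n : ℤ)) fun _ => (n : ℤ)).prod
    (finite_Icc (fun _ : ι => -(n : ℤ)) fun _ => (n : ℤ))).subset fun p hp => ?_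
  refine ⟨⟨fun i => ?_, fun i => ?_⟩, ⟨fun i => ?_, fun i => ?_⟩⟩ <;>
  · have := hp i
    simp only
    omega

omit [Fintype ι] in
theorem isClosed_gridCell (p : (ι → ℤ) × (ι → ℤ)) : IsClosed (gridCell p) := by
  have : gridCell p = Icc (fun i => (p.1 i : ℝ)) fun i => (p.2 i : ℝ) := by
    ext; simp [gridCell, Pi.le_def, forall_and]
  rw [this]
  exact isClosed_Icc

omit [Fintype ι] in
theorem mem_gridCell_carrier (x : ι → ℝ) : x ∈ gridCell (gridCarrier x) :=
  fun i => ⟨Int.floor_le (x i), Int.le_ceil (x i)⟩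

omit [Fintype ι] in
theorem le_gridCarrier {p : (ι → ℤ) × (ι → ℤ)} {x : ι → ℝ} (hx : x ∈ gridCell p) (i : ι) :
    p.1 i ≤ (gridCarrier x).1 i ∧ (gridCarrier x).2 i ≤ p.2 i :=
  ⟨Int.le_floor.2 (hx i).1, Int.ceil_le.2 (hx i).2⟩

omit [Fintype ι] in
theorem gridCell_carrier_subset {p : (ι → ℤ) × (ι → ℤ)} {x : ι → ℝ} (hx : x ∈ gridCell p) :
    gridCell (gridCarrier x) ⊆ gridCell p := fun y hy i => by
  have := le_gridCarrier hx i
  exact ⟨(Int.cast_le.2 this.1).trans (hy i).1, (hy i).2.trans (Int.cast_le.2 this.2)⟩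

theorem gridCell_subset_closedBall {n : ℕ} {p : (ι → ℤ) × (ι → ℤ)} (hp : p ∈ gridCells ι n) :
    gridCell p ⊆ Metric.closedBall 0 n := fun x hx => by
  rw [mem_closedBall_zero_iff, pi_norm_le_iff_of_nonneg (by positivity)]
  intro i
  obtain ⟨h1, h2, h3, h4⟩ := hp i
  have h1' : -(n : ℝ) ≤ p.1 i := by exact_mod_cast h1
  have h4' : (p.2 i : ℝ) ≤ n := by exact_mod_cast h4
  rw [Real.norm_eq_abs, abs_le]
  constructor <;> linarith [(hx i).1, (hx i).2]

theorem gridCarrier_mem {n : ℕ} {x : ι → ℝ} (hx : x ∈ Metric.closedBall (0 : ι → ℝ) n) :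
    gridCarrier x ∈ gridCells ι n := fun i => by
  rw [mem_closedBall_zero_iff, pi_norm_le_iff_of_nonneg (by positivity)] at hx
  have := hx i
  rw [Real.norm_eq_abs, abs_le] at this
  refine ⟨Int.le_floor.2 (by simpa using this.1), Int.floor_le_ceil _, ?_,
    Int.ceil_le.2 (by simpa using this.2)⟩
  exact Int.ceil_le_floor_add_one _

/-- The parametrization of a grid cell by a cube. -/
noncomputable def gridParam (p : (ι → ℤ) × (ι → ℤ)) (u : {i // p.1 i < p.2 i} → I) : ι → ℝ :=
  fun i => p.1 i + if h : p.1 i < p.2 i then (u ⟨i, h⟩ : ℝ) else 0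

omit [Fintype ι] in
theorem isEmbedding_gridParam (p : (ι → ℤ) × (ι → ℤ)) : IsEmbedding (gridParam p) := by
  have hc : Continuous (gridParam p) := by
    refine continuous_pi fun i => ?_
    unfold gridParam
    by_cases h : p.1 i < p.2 i
    · simp only [h, dite_true]; fun_prop
    · simp only [h, dite_false]; fun_prop
  refine (hc.isClosedEmbedding fun u v huv => ?_).isEmbedding
  funext ⟨i, hi⟩
  have := congrFun huv i
  simpa [gridParam, hi, Subtype.ext_iff] using this

omit [Fintype ι] in
theorem gridParam_mem {n : ℕ} {p : (ι → ℤ) × (ι → ℤ)} (hp : p ∈ gridCells ι n)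
    (u : {i // p.1 i < p.2 i} → I) : gridParam p u ∈ gridCell p := fun i => by
  obtain ⟨-, h2, h3, -⟩ := hp i
  by_cases h : p.1 i < p.2 i
  · have : (p.2 i : ℝ) = p.1 i + 1 := by exact_mod_cast (by omega : p.2 i = p.1 i + 1)
    simp only [gridParam, h, dite_true]
    constructor <;> linarith [(u ⟨i, h⟩).2.1, (u ⟨i, h⟩).2.2]
  · have : p.2 i = p.1 i := by omega
    simp [gridParam, this]

omit [Fintype ι] in
theorem image_gridParam {n : ℕ} {p : (ι → ℤ) × (ι → ℤ)} (hp : p ∈ gridCells ι n) :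
    gridParam p '' univ = gridCell p := by
  refine Subset.antisymm (by rintro _ ⟨u, -, rfl⟩; exact gridParam_mem hp u) fun x hx => ?_
  refine ⟨fun i => ⟨x i - p.1 i, ?_, ?_⟩, trivial, ?_⟩
  · linarith [(hx i).1]
  · have : (p.2 i : ℝ) ≤ p.1 i + 1 := by exact_mod_cast (hp i).2.2.1
    linarith [(hx i).2]
  · funext i
    by_cases h : p.1 i < p.2 i
    · simp [gridParam, h]
    · have h2 : p.2 i = p.1 i := by have := (hp i).2.1; omega
      have := hx i
      rw [h2] at this
      simpa [gridParam, h] using le_antisymm this.1 this.2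

omit [Fintype ι] in
theorem image_gridParam_boundary {n : ℕ} {p : (ι → ℤ) × (ι → ℤ)} (hp : p ∈ gridCells ι n) :
    gridParam p '' Cube.boundary _ = {x ∈ gridCell p | gridCarrier x ≠ p} := by
  have key : ∀ u, u ∈ Cube.boundary {i // p.1 i < p.2 i} ↔ gridCarrier (gridParam p u) ≠ p := by
    intro u
    constructor
    · rintro ⟨⟨i, hi⟩, h⟩ hcon
      have h1 := congrFun (congrArg Prod.fst hcon) i
      have h2 := congrFun (congrArg Prod.snd hcon) i
      have hi' := hi
      rcases h with h | h <;>
        simp only [gridCarrier, gridParam, hi, dite_true, h, Icc.coe_zero, Icc.coe_one, add_zero,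
          Int.ceil_intCast, Int.floor_add_one, Int.floor_intCast] at h1 h2 <;> omega
    · intro h
      by_contra hcon
      simp only [Cube.boundary, mem_ofPred_eq, not_exists, not_or] at hcon
      apply h
      refine Prod.ext (funext fun i => ?_) (funext fun i => ?_) <;>
        by_cases hi : p.1 i < p.2 i
      · have h0 : (0 : ℝ) < u ⟨i, hi⟩ := unitInterval.pos_iff_ne_zero.2 (hcon ⟨i, hi⟩).1
        have h1 : (u ⟨i, hi⟩ : ℝ) < 1 := unitInterval.lt_one_iff_ne_one.2 (hcon ⟨i, hi⟩).2
        simp only [gridCarrier, gridParam, hi, dite_true]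
        rw [Int.floor_eq_iff]
        constructor <;> linarith
      · simp [gridCarrier, gridParam, hi]
      · have h0 : (0 : ℝ) < u ⟨i, hi⟩ := unitInterval.pos_iff_ne_zero.2 (hcon ⟨i, hi⟩).1
        have h1 : (u ⟨i, hi⟩ : ℝ) < 1 := unitInterval.lt_one_iff_ne_one.2 (hcon ⟨i, hi⟩).2
        have h2 : (p.2 i : ℝ) = p.1 i + 1 := by
          have := (hp i).2.2.1
          exact_mod_cast (by omega : p.2 i = p.1 i + 1)
        simp only [gridCarrier, gridParam, hi, dite_true]
        rw [Int.ceil_eq_iff]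
        constructor <;> linarith
      · have h2 : p.2 i = p.1 i := by have := (hp i).2.1; omega
        simp [gridCarrier, gridParam, h2]
  ext x
  constructor
  · rintro ⟨u, hu, rfl⟩
    exact ⟨gridParam_mem hp u, (key u).1 hu⟩
  · rintro ⟨hx, hx'⟩
    rw [← image_gridParam hp] at hx
    obtain ⟨u, -, rfl⟩ := hx
    exact ⟨u, (key u).2 hx', rfl⟩

/-- Cell induction on the integral grid: each cell is a cube whose boundary consists of the points
with a smaller carrier. -/
theorem IsCubeLifting.liftsOn_grid {q : E → B} (hq : IsCubeLifting q) {n : ℕ} {h : (ι → ℝ) → B}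
    (hh : ContinuousOn h (Metric.closedBall 0 n)) {D : Set (ι → ℝ)} (hD : IsClosed D)
    (hDn : D ⊆ Metric.closedBall 0 n) (hDc : ∀ x ∈ D, gridCell (gridCarrier x) ⊆ D) :
    LiftsOn q h D (Metric.closedBall 0 n) := by
  classical
  have hU : (⋃ p ∈ gridCells ι n, gridCell p) = Metric.closedBall 0 n :=
    Subset.antisymm (iUnion₂_subset fun p hp => gridCell_subset_closedBall hp) fun x hx =>
      mem_biUnion (gridCarrier_mem hx) (mem_gridCell_carrier x)
  have := LiftsOn.cells (gridCells ι n) (finite_gridCells n) gridCell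
    (fun p => ∑ i, (p.2 i - p.1 i).toNat) gridCarrier (fun p _ => isClosed_gridCell p)
    (fun p hp x hx => ⟨gridCarrier_mem (gridCell_subset_closedBall hp hx), mem_gridCell_carrier x,
      gridCell_carrier_subset hx, ?_⟩) (q := q) (h := h) isClosed_empty (fun p hp => ?_) D hD
    fun x hx => ⟨gridCarrier_mem (hDn hx), mem_gridCell_carrier x, hDc x hx⟩
  · simpa only [empty_union, hU] using this
  · by_cases hne : gridCarrier x = p
    · exact Or.inl hne
    · refine Or.inr (Finset.sum_lt_sum (fun i _ => ?_) ?_)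
      · have := le_gridCarrier hx i
        omega
      · by_contra hcon
        push Not at hcon
        apply hne
        have h3 : ∀ i, (gridCarrier x).1 i = p.1 i ∧ (gridCarrier x).2 i = p.2 i := fun i => by
          have h1 := le_gridCarrier hx i
          have h2 := hcon i (Finset.mem_univ i)
          have h3 := (hp i).2.1
          have h4 : (gridCarrier x).1 i ≤ (gridCarrier x).2 i := Int.floor_le_ceil (x i)
          omega
        exact Prod.ext (funext fun i => (h3 i).1) (funext fun i => (h3 i).2)
  · rw [inter_empty, union_empty, ← image_gridParam_boundary hp, ← image_gridParam hp]
    refine LiftsOn.image (isEmbedding_gridParam p) (hq.liftsOn_cube ?_)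
    exact hh.comp_continuous (isEmbedding_gridParam p).continuous fun u =>
      gridCell_subset_closedBall hp (gridParam_mem hp u)

/-- Extension of a lift from a union of coordinate subspaces and a neighbourhood of a compact set
to the unit cube. -/
theorem IsCubeLifting.exists_lift_box {q : E → B} (hq : IsCubeLifting q) {h : (ι → ℝ) → B}
    (hh : ContinuousOn h (Metric.closedBall 0 1)) {A : Set (ι → ℝ)} (hA : IsClosed A)
    (hA1 : A ⊆ Metric.closedBall 0 1)
    (hAc : ∀ x ∈ A, ∀ y ∈ Metric.closedBall (0 : ι → ℝ) 1, (∀ i, x i = 0 → y i = 0) → y ∈ A)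
    {C U : Set (ι → ℝ)} (hC : IsCompact C) (hU : IsOpen U) (hCU : C ⊆ U)
    {g : (ι → ℝ) → E} (hg : ContinuousOn g (A ∪ (U ∩ Metric.closedBall 0 1)))
    (hgh : ∀ x ∈ A ∪ (U ∩ Metric.closedBall 0 1), q (g x) = h x) :
    ∃ (g' : (ι → ℝ) → E) (V : Set (ι → ℝ)), IsOpen V ∧ C ⊆ V ∧
      ContinuousOn g' (Metric.closedBall 0 1) ∧ (∀ x ∈ Metric.closedBall 0 1, q (g' x) = h x) ∧
      EqOn g' g (A ∪ (V ∩ Metric.closedBall 0 1)) := by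
  obtain ⟨δ, hδ, hδU⟩ := hC.exists_thickening_subset_open hU hCU
  obtain ⟨m, hm⟩ := exists_nat_one_div_lt hδ
  let n := m + 1
  have hn : (0 : ℝ) < n := by positivity
  have hnδ : (n : ℝ)⁻¹ < δ := by simpa [n] using hm
  -- The integral grid scaled to mesh 1/n < δ, so that every cell meeting C lies in U.
  let e : (ι → ℝ) ≃ₜ (ι → ℝ) := Homeomorph.smulOfNeZero (n : ℝ)⁻¹ (by positivity)
  have he : ∀ x i, e x i = (n : ℝ)⁻¹ * x i := fun x i => rfl
  have heball : e '' Metric.closedBall 0 n = Metric.closedBall 0 1 := by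
    change (fun x => (n : ℝ)⁻¹ • x) '' _ = _
    rw [image_smul, smul_closedBall' (by positivity)]
    simp [hn.ne']
  have heball' : ∀ x, e x ∈ Metric.closedBall (0 : ι → ℝ) 1 ↔ x ∈ Metric.closedBall (0 : ι → ℝ) n :=
    fun x => by rw [← heball, e.injective.mem_set_image]
  let near : Set ((ι → ℤ) × (ι → ℤ)) := {p ∈ gridCells ι n | (gridCell p ∩ e ⁻¹' C).Nonempty}
  let far : Set ((ι → ℤ) × (ι → ℤ)) := {p ∈ gridCells ι n | ¬ (gridCell p ∩ e ⁻¹' C).Nonempty}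
  have hnear : near.Finite := (finite_gridCells n).subset (sep_subset _ _)
  have hfar : far.Finite := (finite_gridCells n).subset (sep_subset _ _)
  have hnearcl : IsClosed (⋃ p ∈ near, gridCell p) :=
    hnear.isClosed_biUnion fun p _ => isClosed_gridCell p
  have hfarcl : IsClosed (⋃ p ∈ far, gridCell p) :=
    hfar.isClosed_biUnion fun p _ => isClosed_gridCell p
  let D : Set (ι → ℝ) := e ⁻¹' A ∪ ⋃ p ∈ near, gridCell p
  have hDsub : D ⊆ Metric.closedBall 0 n := by
    rintro x (hx | hx)
    · exact (heball' x).1 (hA1 hx)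
    · obtain ⟨p, hp, hx⟩ := mem_iUnion₂.1 hx
      exact gridCell_subset_closedBall hp.1 hx
  have hL : LiftsOn q (h ∘ e) D (Metric.closedBall 0 n) := by
    refine hq.liftsOn_grid (hh.comp e.continuous.continuousOn fun x hx => (heball' x).2 hx)
      ((hA.preimage e.continuous).union hnearcl) hDsub ?_
    rintro x (hx | hx)
    · intro y hy
      refine Or.inl (hAc _ hx _ ((heball' y).2 ?_) fun i hi => ?_)
      · exact gridCell_subset_closedBall (gridCarrier_mem ((heball' x).1 (hA1 hx))) hy
      -- The grid passes through the origin: a coordinate that is zero at x is zero on the whole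
      -- carrier of x. Hence A is a union of cells.
      · rw [he, mul_eq_zero_iff_left (by positivity)] at hi
        have := hy i
        simp only [gridCarrier, hi, Int.floor_zero, Int.ceil_zero, Int.cast_zero] at this
        rw [he, le_antisymm this.2 this.1, mul_zero]
    · obtain ⟨p, hp, hx⟩ := mem_iUnion₂.1 hx
      exact (gridCell_carrier_subset hx).trans
        ((subset_biUnion_of_mem (u := gridCell) hp).trans subset_union_right)
  have hDU : e '' D ⊆ A ∪ (U ∩ Metric.closedBall 0 1) := by
    rintro _ ⟨x, hx | hx, rfl⟩
    · exact Or.inl hx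
    · refine Or.inr ⟨hδU ?_, (heball' x).2 (hDsub (Or.inr hx))⟩
      obtain ⟨p, hp, hx⟩ := mem_iUnion₂.1 hx
      obtain ⟨y, hy, hyC⟩ := hp.2
      refine Metric.mem_thickening_iff.2 ⟨e y, hyC, lt_of_le_of_lt ?_ hnδ⟩
      refine (dist_pi_le_iff (by positivity)).2 fun i => ?_
      have h1 : (p.2 i : ℝ) ≤ p.1 i + 1 := by exact_mod_cast (hp.1 i).2.2.1
      have h2 : |x i - y i| ≤ 1 := by
        rw [abs_le]
        constructor <;> linarith [(hx i).1, (hx i).2, (hy i).1, (hy i).2]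
      rw [Real.dist_eq, he, he, ← mul_sub, abs_mul, abs_of_pos (by positivity)]
      exact mul_le_of_le_one_right (by positivity) h2
  obtain ⟨g', hg', hgg', hgh'⟩ :=
    LiftsOn.image e.isEmbedding hL g (hg.mono hDU) fun x hx => hgh x (hDU hx)
  rw [heball] at hg' hgh'
  -- Deleting the finitely many closed cells that miss C leaves an open neighbourhood of C whose
  -- points in the box lie in cells meeting C, where the lift was prescribed.
  refine ⟨g', (e '' ⋃ p ∈ far, gridCell p)ᶜ, (e.isClosedMap _ hfarcl).isOpen_compl, ?_, hg', hgh',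
    ?_⟩
  · rintro x hx ⟨y, hy, rfl⟩
    obtain ⟨p, hp, hy⟩ := mem_iUnion₂.1 hy
    exact hp.2 ⟨y, hy, hx⟩
  · rintro x (hx | ⟨hxV, hx⟩)
    · exact hgg' ⟨e.symm x, Or.inl (by simpa using hx), by simp⟩
    · rw [← heball] at hx
      obtain ⟨y, hy, rfl⟩ := hx
      refine hgg' ⟨y, Or.inr ?_, rfl⟩
      refine mem_biUnion (x := gridCarrier y) ⟨gridCarrier_mem hy, ?_⟩ (mem_gridCell_carrier y)
      by_contra hcon
      exact hxV ⟨y, mem_biUnion (x := gridCarrier y) ⟨gridCarrier_mem hy, hcon⟩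
        (mem_gridCell_carrier y), rfl⟩

end Grid

/-! ### Slice charts for closed submanifolds -/

section Slices

variable {S : Type*} [TopologicalSpace S]

/-- Near `s`, in a suitable chart with values in `ℝ^ι`, the set `A` is empty or a coordinate
subspace. -/
def IsSliceAt (A : Set S) (s : S) : Prop :=
  ∃ (ι : Type) (_ : Fintype ι) (e : OpenPartialHomeomorph S (ι → ℝ)), s ∈ e.source ∧ e s = 0 ∧
    Metric.closedBall 0 1 ⊆ e.target ∧
    ∀ x ∈ e.source, ∀ y ∈ e.source, (∀ i, e x i = 0 → e y i = 0) → x ∈ A → y ∈ A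

theorem OpenPartialHomeomorph.exists_rescale {ι : Type*} [Fintype ι]
    (e : OpenPartialHomeomorph S (ι → ℝ)) {s : S} (hs : s ∈ e.source) {U : Set S} (hU : IsOpen U)
    (hsU : s ∈ U) :
    ∃ e' : OpenPartialHomeomorph S (ι → ℝ), s ∈ e'.source ∧ e' s = 0 ∧
      Metric.closedBall 0 1 ⊆ e'.target ∧ e'.source ⊆ e.source ∩ U ∧
      ∃ c : ℝ, c ≠ 0 ∧ ∀ x, e' x = c • (e x - e s) := by
  let e₁ := e.restrOpen U hU
  have hs₁ : s ∈ e₁.source := by simpa [e₁] using ⟨hs, hsU⟩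
  obtain ⟨ε, hε, hball⟩ := Metric.nhds_basis_closedBall.mem_iff.1
    (e₁.open_target.mem_nhds (e₁.map_source hs₁))
  let T : (ι → ℝ) ≃ₜ (ι → ℝ) :=
    (Homeomorph.subRight (e s)).trans (Homeomorph.smulOfNeZero ε⁻¹ (by positivity))
  have hT : ∀ v, T v = ε⁻¹ • (v - e s) := fun v => rfl
  refine ⟨e₁.transHomeomorph T, hs₁, ?_, ?_, ?_, ε⁻¹, by positivity, fun x => rfl⟩
  · change T (e s) = 0
    simp [hT]
  · intro v hv
    change T.symm v ∈ e₁.target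
    refine hball ?_
    have h1 : ε⁻¹ • (T.symm v - e s) = v := by rw [← hT, T.apply_symm_apply]
    rw [mem_closedBall_zero_iff, ← h1, norm_smul, norm_inv, Real.norm_of_nonneg hε.le,
      inv_mul_le_iff₀ hε, mul_one] at hv
    rw [mem_closedBall_iff_norm]
    exact hv
  · change e₁.source ⊆ _
    simp [e₁]

theorem isSliceAt_of_notMem {a : ℕ} [ChartedSpace (Cn a) S] {A : Set S} (hA : IsClosed A) {s : S}
    (hs : s ∉ A) : IsSliceAt A s := by
  let e := (chartAt (Cn a) s).transHomeomorph
    (Module.finBasis ℝ (Cn a)).equivFunL.toHomeomorph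
  obtain ⟨e', h1, h2, h3, h4, -⟩ := e.exists_rescale (s := s) (mem_chart_source _ s)
    hA.isOpen_compl hs
  exact ⟨_, inferInstance, e', h1, h2, h3, fun x hx y _ _ hxA => ((h4 hx).2 hxA).elim⟩

theorem isSliceAt_range {a b : ℕ} [ChartedSpace (Cn a) S] {T : Type*} [TopologicalSpace T]
    [ChartedSpace (Cn b) T] {f : T → S}
    (hf : Manifold.IsSmoothEmbedding 𝓘(ℂ, Cn b) 𝓘(ℂ, Cn a) ω f) (t : T) :
    IsSliceAt (range f) (f t) := by
  obtain ⟨F, _, _, h⟩ := hf.isImmersion.isImmersionAt t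
  let φ := h.domChart
  let ψ := h.codChart
  let L := h.equiv
  have hφt : t ∈ φ.source := h.mem_domChart_source
  have hmaps : ∀ x ∈ φ.source, f x ∈ ψ.source := fun x hx => h.source_subset_preimage_source hx
  have hwr : ∀ x ∈ φ.source, ψ (f x) = L (φ x, 0) := by
    intro x hx
    have hw := h.writtenInCharts
    have := @hw (φ x) (by
      rw [OpenPartialHomeomorph.extend_target]
      exact ⟨φ.map_source hx, φ x, rfl⟩)
    simpa [φ.left_inv hx, φ, ψ] using this
  have : FiniteDimensional ℂ F := FiniteDimensional.of_injective
    (L.toLinearEquiv.toLinearMap ∘ₗ LinearMap.inr ℂ (Cn b) F)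
    (L.injective.comp (Prod.mk_right_injective 0))
  have : FiniteDimensional ℝ F := FiniteDimensional.complexToReal F
  let e₂ : F ≃L[ℝ] (Fin (Module.finrank ℝ F) → ℝ) := (Module.finBasis ℝ F).equivFunL
  let Λ : Cn a ≃ₜ (Fin (Module.finrank ℝ (Cn b)) ⊕ Fin (Module.finrank ℝ F) → ℝ) :=
    L.symm.toHomeomorph.trans (((Module.finBasis ℝ (Cn b)).equivFunL.toHomeomorph.prodCongr
      e₂.toHomeomorph).trans Homeomorph.sumArrowHomeomorphProdArrow.symm)
  have hΛ : ∀ v, (∀ j, Λ v (Sum.inr j) = 0) ↔ (L.symm v).2 = 0 := by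
    intro v
    have : ∀ j, Λ v (Sum.inr j) = e₂ (L.symm v).2 j := fun j => rfl
    simp only [this]
    rw [← e₂.map_eq_zero_iff, funext_iff]
    rfl
  let e := ψ.transHomeomorph Λ
  have he : ∀ x, e x = Λ (ψ x) := fun x => rfl
  -- Because f is an embedding and not merely an immersion, W keeps other parts of the image out of
  -- the chart.
  obtain ⟨W, hW, hWf⟩ := hf.isEmbedding.isOpen_iff.1 φ.open_source
  have hU : IsOpen ((ψ.source ∩ ψ ⁻¹' {v | (L.symm v).1 ∈ φ.target}) ∩ W) := by
    refine (ψ.isOpen_inter_preimage ?_).inter hW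
    exact φ.open_target.preimage (by fun_prop)
  have hft : f t ∈ (ψ.source ∩ ψ ⁻¹' {v | (L.symm v).1 ∈ φ.target}) ∩ W := by
    refine ⟨⟨hmaps t hφt, ?_⟩, ?_⟩
    · simpa [hwr t hφt] using φ.map_source hφt
    · change t ∈ f ⁻¹' W
      rwa [hWf]
  -- Recentring at f t and scaling preserve the vanishing of the normal coordinates, because these
  -- already vanish at f t.
  obtain ⟨e', h1, h2, h3, h4, c, hc, h5⟩ := e.exists_rescale (s := f t) (hmaps t hφt) hU hft
  have hz : ∀ x ∈ φ.source, ∀ j, e (f x) (Sum.inr j) = 0 := fun x hx =>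
    (hΛ _).2 (by simp [hwr x hx])
  refine ⟨_, inferInstance, e', h1, h2, h3, ?_⟩
  rintro x hx y hy hxy ⟨x', rfl⟩
  have hx' : x' ∈ φ.source := by
    rw [← hWf]
    exact (h4 hx).2.2
  have hy0 : (L.symm (ψ y)).2 = 0 := by
    refine (hΛ _).1 fun j => ?_
    have := hxy (Sum.inr j) (by simp [h5, hz x' hx' j, hz t hφt j])
    rw [h5] at this
    rw [← he]
    simpa [hz t hφt j, hc] using this
  have hy1 : (L.symm (ψ y)).1 ∈ φ.target := (h4 hy).2.1.2
  refine ⟨φ.symm (L.symm (ψ y)).1, ψ.injOn (hmaps _ (φ.map_target hy1)) (h4 hy).2.1.1 ?_⟩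
  rw [hwr _ (φ.map_target hy1), φ.right_inv hy1, ← hy0]
  simp

end Slices

/-! ### Patching lifts over a manifold -/

section Patching

variable {E B S : Type*} [TopologicalSpace E] [TopologicalSpace B] [TopologicalSpace S]

/-- One step of the patching: the domain of the lift grows by half a chart box. The lift may change
near the box but not on A ∪ C, which is what makes infinitely many steps converge. -/
theorem IsCubeLifting.exists_lift_chart [T2Space S] {q : E → B} (hq : IsCubeLifting q) {h : S → B}
    (hh : Continuous h) {ι : Type*} [Fintype ι] (e : OpenPartialHomeomorph S (ι → ℝ))
    (he : Metric.closedBall 0 1 ⊆ e.target) {A : Set S} (hA : IsClosed A)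
    (heA : ∀ x ∈ e.source, ∀ y ∈ e.source, (∀ i, e x i = 0 → e y i = 0) → x ∈ A → y ∈ A)
    {C O : Set S} (hC : IsCompact C) (hO : IsOpen O) (hCO : C ⊆ O) {g : S → E}
    (hg : ContinuousOn g (A ∪ O)) (hgh : ∀ x ∈ A ∪ O, q (g x) = h x) :
    ∃ (g' : S → E) (O' : Set S), IsOpen O' ∧ C ∪ e.symm '' Metric.closedBall 0 (1 / 2) ⊆ O' ∧
      ContinuousOn g' (A ∪ O') ∧ (∀ x ∈ A ∪ O', q (g' x) = h x) ∧ EqOn g' g (A ∪ C) := by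
  classical
  let box : Set (ι → ℝ) := Metric.closedBall 0 1
  let K : Set S := e.symm '' box
  have hes : ContinuousOn e.symm box := e.symm.continuousOn.mono he
  have hK : IsCompact K := (isCompact_closedBall _ _).image_of_continuousOn hes
  have hKs : K ⊆ e.source := by
    rintro _ ⟨x, hx, rfl⟩
    exact e.map_target (he hx)
  have hKe : ∀ x ∈ K, e x ∈ box := by
    rintro _ ⟨x, hx, rfl⟩
    rwa [e.right_inv (he hx)]
  have hKi : ∀ x ∈ K, e.symm (e x) = x := fun x hx => e.left_inv (hKs hx)
  let A' : Set (ι → ℝ) := box ∩ e.symm ⁻¹' A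
  let U : Set (ι → ℝ) := e.target ∩ e.symm ⁻¹' O
  have hmaps : MapsTo e.symm (A' ∪ (U ∩ box)) (A ∪ O) := by
    rintro x (hx | hx)
    · exact Or.inl hx.2
    · exact Or.inr hx.1.2
  obtain ⟨g₁, V, hV, hCV, hg₁, hg₁h, hg₁g⟩ := hq.exists_lift_box (h := h ∘ e.symm)
    (hh.comp_continuousOn hes) (A := A') (hes.preimage_isClosed_of_isClosed
      Metric.isClosed_closedBall hA) inter_subset_left
    (fun x hx y hy hxy => ⟨hy, heA _ (e.map_target (he hx.1)) _ (e.map_target (he hy))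
      (by rwa [e.right_inv (he hx.1), e.right_inv (he hy)]) hx.2⟩)
    (C := e '' (C ∩ K)) (U := U)
    ((hC.inter hK).image_of_continuousOn (e.continuousOn.mono fun x hx => hKs hx.2))
    (e.symm.isOpen_inter_preimage hO)
    (by
      rintro _ ⟨x, hx, rfl⟩
      refine ⟨e.map_source (hKs hx.2), ?_⟩
      change e.symm (e x) ∈ O
      rw [hKi x hx.2]
      exact hCO hx.1)
    (g := g ∘ e.symm)
    (hg.comp (hes.mono (union_subset inter_subset_left inter_subset_right)) hmaps)
    fun x hx => hgh _ (hmaps hx)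
  -- The part of the box where the new lift may differ from g. It is compact and misses C, so
  -- removing it from O leaves a neighbourhood of C.
  let R : Set S := e.symm '' (box \ V)
  have hR : IsCompact R :=
    ((isCompact_closedBall _ _).diff hV).image_of_continuousOn (hes.mono sdiff_subset)
  have hCR : ∀ x ∈ C, x ∉ R := by
    rintro _ hx ⟨v, ⟨hv, hvV⟩, rfl⟩
    refine hvV (hCV ?_)
    rw [← e.right_inv (he hv)]
    exact mem_image_of_mem e ⟨hx, mem_image_of_mem _ hv⟩
  let g' : S → E := fun x => if x ∈ K then g₁ (e x) else g x
  have hg'K : EqOn g' (g₁ ∘ e) K := fun x hx => by simp [g', hx]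
  let D : Set S := A ∪ (O \ R)
  have hg'D : EqOn g' g D := by
    intro x hx
    by_cases hxK : x ∈ K
    · rw [hg'K hxK, Function.comp_apply, hg₁g, Function.comp_apply, hKi x hxK]
      rcases hx with hx | hx
      · refine Or.inl ⟨hKe x hxK, ?_⟩
        change e.symm (e x) ∈ A
        rwa [hKi x hxK]
      · refine Or.inr ⟨?_, hKe x hxK⟩
        by_contra hcon
        exact hx.2 ⟨e x, ⟨hKe x hxK, hcon⟩, hKi x hxK⟩
    · simp [g', hxK]
  have hKc : ContinuousOn g' K :=
    (ContinuousOn.comp (t := box) hg₁ (e.continuousOn.mono hKs) hKe).congr hg'K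
  have hDc : ContinuousOn g' D :=
    (hg.mono (union_subset_union_right _ sdiff_subset)).congr hg'D
  refine ⟨g', (O \ R) ∪ interior K, (hO.sdiff hR.isClosed).union isOpen_interior, ?_, ?_, ?_, ?_⟩
  · rintro x (hx | ⟨v, hv, rfl⟩)
    · exact Or.inl ⟨hCO hx, hCR x hx⟩
    · refine Or.inr (mem_interior.2 ⟨e.source ∩ e ⁻¹' Metric.ball 0 1, ?_,
        e.isOpen_inter_preimage Metric.isOpen_ball, ?_⟩)
      · rintro x ⟨hx, hx'⟩
        exact ⟨e x, Metric.ball_subset_closedBall hx', e.left_inv hx⟩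
      · have hv1 : v ∈ Metric.ball (0 : ι → ℝ) 1 :=
          Metric.closedBall_subset_ball (by norm_num) hv
        have hvt := he (Metric.ball_subset_closedBall hv1)
        refine ⟨e.map_target hvt, ?_⟩
        change e (e.symm v) ∈ Metric.ball (0 : ι → ℝ) 1
        rwa [e.right_inv hvt]
  · rw [← union_assoc]
    intro x hx
    by_cases hxi : x ∈ interior K
    · exact (hKc.continuousAt (mem_interior_iff_mem_nhds.1 hxi)).continuousWithinAt
    · have hxD : x ∈ D := hx.resolve_right hxi
      refine ContinuousWithinAt.mono ?_ (union_subset_union_right D interior_subset)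
      refine (hDc x hxD).union ?_
      by_cases hxK : x ∈ K
      · exact hKc x hxK
      · exact continuousWithinAt_of_notMem_closure (by rwa [hK.isClosed.closure_eq])
  · rw [← union_assoc]
    rintro x (hx | hx)
    · rw [hg'D hx]
      exact hgh x (union_subset_union_right _ sdiff_subset hx)
    · have hxK := interior_subset hx
      rw [hg'K hxK]
      change q (g₁ (e x)) = h x
      rw [hg₁h _ (hKe x hxK), Function.comp_apply, hKi x hxK]
  · have hCD : C ⊆ O \ R := fun x hx => ⟨hCO hx, hCR x hx⟩
    exact hg'D.mono (union_subset_union_right _ hCD)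

/-- A map with the right lifting property for all `(I^n, ∂I^n)` has it for all pairs consisting of a
manifold and a closed submanifold. -/
theorem IsCubeLifting.liftsOn_of_isSliceAt [T2Space S] [SecondCountableTopology S] {q : E → B}
    (hq : IsCubeLifting q) {A : Set S} (hA : IsClosed A) (hAs : ∀ s, IsSliceAt A s) {h : S → B}
    (hh : Continuous h) : LiftsOn q h A univ := by
  classical
  intro g hg hgh
  rcases isEmpty_or_nonempty S with hS | hS
  · exact ⟨g, fun x => isEmptyElim x, fun _ _ => rfl, fun x => isEmptyElim x⟩
  choose ι _ e h1 h2 h3 h4 using hAs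
  let K : S → Set S := fun s => (e s).symm '' Metric.closedBall 0 (1 / 2)
  have hball : ∀ s, Metric.closedBall (0 : ι s → ℝ) (1 / 2) ⊆ (e s).target := fun s =>
    (Metric.closedBall_subset_closedBall (by norm_num)).trans (h3 s)
  have hK : ∀ s, IsCompact (K s) := fun s =>
    (isCompact_closedBall _ _).image_of_continuousOn ((e s).symm.continuousOn.mono (hball s))
  have hKn : ∀ s, K s ∈ 𝓝 s := fun s => by
    refine Filter.mem_of_superset (((e s).isOpen_inter_preimage
      (Metric.isOpen_ball (x := 0) (ε := 1 / 2))).mem_nhds ⟨h1 s, ?_⟩) ?_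
    · simp [h2]
    · rintro x ⟨hx, hx'⟩
      exact ⟨e s x, Metric.ball_subset_closedBall hx', (e s).left_inv hx⟩
  obtain ⟨c, hc, hcU⟩ := TopologicalSpace.countable_cover_nhds fun s => interior_mem_nhds.2 (hKn s)
  have hcne : c.Nonempty := by
    by_contra hcon
    rw [not_nonempty_iff_eq_empty] at hcon
    obtain ⟨s⟩ := hS
    have : s ∈ ⋃ x ∈ c, interior (K x) := hcU ▸ mem_univ s
    simp [hcon] at this
  obtain ⟨s, rfl⟩ := hc.exists_eq_range hcne
  let C : ℕ → Set S := fun j => ⋃ i ∈ Finset.range j, K (s i)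
  have hC : ∀ j, IsCompact (C j) := fun j => (Finset.range j).isCompact_biUnion fun i _ => hK _
  have hCs : ∀ j, C (j + 1) = C j ∪ K (s j) := fun j => by
    simp only [C, Finset.range_add_one, Finset.set_biUnion_insert]
    rw [union_comm]
  let P : ℕ → (S → E) × Set S → Prop := fun j p => IsOpen p.2 ∧ C j ⊆ p.2 ∧
    ContinuousOn p.1 (A ∪ p.2) ∧ ∀ x ∈ A ∪ p.2, q (p.1 x) = h x
  have step : ∀ j (p : {p // P j p}), ∃ p' : {p // P (j + 1) p}, EqOn p'.1.1 p.1.1 (A ∪ C j) := by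
    rintro j ⟨p, hp1, hp2, hp3, hp4⟩
    obtain ⟨g', O', k1, k2, k3, k4, k5⟩ := hq.exists_lift_chart hh (e (s j)) (h3 _) hA (h4 _) (hC j)
      hp1 hp2 hp3 hp4
    exact ⟨⟨(g', O'), k1, by rwa [hCs], k3, k4⟩, k5⟩
  choose next hnext using step
  -- Lifts over A ∪ O_j, beginning with g and O_0 = ∅. From stage j on nothing changes on A ∪ C_j,
  -- so the sequence is eventually constant on each K (s i).
  let F : (j : ℕ) → {p // P j p} := fun j => Nat.rec (motive := fun j => {p // P j p})
    ⟨(g, ∅), isOpen_empty, by simp [C], by simpa using hg, by simpa using hgh⟩ next j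
  have hF0 : (F 0).1.1 = g := rfl
  have hFs : ∀ j, EqOn (F (j + 1)).1.1 (F j).1.1 (A ∪ C j) := fun j => hnext j (F j)
  have hCm : Monotone C := monotone_nat_of_le_succ fun j => by
    rw [hCs]; exact subset_union_left
  have hFle : ∀ i j, i ≤ j → EqOn (F j).1.1 (F i).1.1 (A ∪ C i) := by
    intro i j hij
    induction j, hij using Nat.le_induction with
    | base => exact fun _ _ => rfl
    | succ j hij ih =>
      exact ((hFs j).mono (union_subset_union_right _ (hCm hij))).trans ih
  have hcov' : ∀ x, ∃ j, x ∈ interior (K (s j)) := fun x => by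
    have : x ∈ ⋃ y ∈ range s, interior (K y) := hcU ▸ mem_univ x
    simpa using this
  have hcov : ∀ x, ∃ j, x ∈ K (s j) := fun x => (hcov' x).imp fun _ hx => interior_subset hx
  choose idx hidx using hcov
  have hKC : ∀ j, K (s j) ⊆ C (j + 1) := fun j => by rw [hCs]; exact subset_union_right
  let G : S → E := fun x => (F (idx x + 1)).1.1 x
  have hG : ∀ j, EqOn G (F (j + 1)).1.1 (K (s j)) := by
    intro j x hx
    rcases le_total (idx x) j with hle | hle
    · exact (hFle _ _ (Nat.succ_le_succ hle) (Or.inr (hKC _ (hidx x)))).symm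
    · exact hFle _ _ (Nat.succ_le_succ hle) (Or.inr (hKC _ hx))
  refine ⟨G, continuousOn_univ.2 (continuous_iff_continuousAt.2 fun x => ?_), fun x hx => ?_,
    fun x _ => ?_⟩
  · obtain ⟨j, hj⟩ := hcov' x
    have hO := (F (j + 1)).2.1.mem_nhds ((F (j + 1)).2.2.1 (hKC j (interior_subset hj)))
    exact (((F (j + 1)).2.2.2.1).continuousAt
      (Filter.mem_of_superset hO subset_union_right)).congr
      (Filter.mem_of_superset (mem_interior_iff_mem_nhds.1 hj) fun y hy => (hG j hy).symm)
  · exact hFle 0 (idx x + 1) (Nat.zero_le _) (Or.inl hx)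
  · exact (F (idx x + 1)).2.2.2.2 x (Or.inr ((F (idx x + 1)).2.2.1 (hKC _ (hidx x))))

end Patching

/-! ### Simplices as cubes -/

section Simplex

/-- The convex hull of the origin and the standard basis of `ℝ^k`. -/
def cornerSimplex (k : ℕ) : Set (Fin k → ℝ) := {x | (∀ i, 0 ≤ x i) ∧ ∑ i, x i ≤ 1}

theorem isClosed_cornerSimplex (k : ℕ) : IsClosed (cornerSimplex k) := by
  have : cornerSimplex k = (⋂ i, {x | 0 ≤ x i}) ∩ {x | ∑ i, x i ≤ 1} := by
    ext; simp [cornerSimplex]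
  rw [this]
  exact (isClosed_iInter fun i => isClosed_le continuous_const (continuous_apply i)).inter
    (isClosed_le (by fun_prop) continuous_const)

theorem convex_cornerSimplex (k : ℕ) : Convex ℝ (cornerSimplex k) := by
  rintro x ⟨hx, hx'⟩ y ⟨hy, hy'⟩ a b ha hb hab
  refine ⟨fun i => ?_, ?_⟩
  · have := mul_nonneg ha (hx i)
    have := mul_nonneg hb (hy i)
    simp only [Pi.add_apply, Pi.smul_apply, smul_eq_mul]
    linarith
  · simp only [Pi.add_apply, Pi.smul_apply, smul_eq_mul, Finset.sum_add_distrib, ← Finset.mul_sum]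
    nlinarith

theorem isBounded_cornerSimplex (k : ℕ) : Bornology.IsBounded (cornerSimplex k) := by
  refine (Metric.isBounded_closedBall (x := 0) (r := 1)).subset fun x hx => ?_
  rw [mem_closedBall_zero_iff, pi_norm_le_iff_of_nonneg zero_le_one]
  intro i
  rw [Real.norm_of_nonneg (hx.1 i)]
  exact (Finset.single_le_sum (fun j _ => hx.1 j) (Finset.mem_univ i)).trans hx.2

theorem interior_cornerSimplex (k : ℕ) :
    interior (cornerSimplex k) = {x | (∀ i, 0 < x i) ∧ ∑ i, x i < 1} := by
  apply Subset.antisymm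
  · intro x hx
    have key : ∀ v : Fin k → ℝ, ∃ t : ℝ, 0 < t ∧ x + t • v ∈ cornerSimplex k := by
      intro v
      have hc : ContinuousAt (fun t : ℝ => x + t • v) 0 := by fun_prop
      have := hc.preimage_mem_nhds (t := cornerSimplex k)
        (by simpa using mem_interior_iff_mem_nhds.1 hx)
      obtain ⟨ε, hε, hball⟩ := Metric.mem_nhds_iff.1 this
      refine ⟨ε / 2, by positivity, hball ?_⟩
      rw [Metric.mem_ball, dist_zero_right, Real.norm_of_nonneg (by positivity)]
      linarith
    constructor
    · intro i
      obtain ⟨t, ht, hxt⟩ := key fun _ => -1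
      have := hxt.1 i
      simp only [Pi.add_apply, Pi.smul_apply, smul_eq_mul] at this
      linarith
    · obtain ⟨t, ht, hxt⟩ := key fun _ => 1
      have := hxt.2
      simp only [Pi.add_apply, Pi.smul_apply, smul_eq_mul, mul_one, Finset.sum_add_distrib,
        Finset.sum_const, Finset.card_univ, Fintype.card_fin, nsmul_eq_mul] at this
      rcases Nat.eq_zero_or_pos k with rfl | hk
      · simp
      · have : 0 < (k : ℝ) * t := by positivity
        linarith
  · refine interior_maximal (fun x hx => ⟨fun i => (hx.1 i).le, hx.2.le⟩) ?_
    have : {x : Fin k → ℝ | (∀ i, 0 < x i) ∧ ∑ i, x i < 1} =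
        (⋂ i, {x | 0 < x i}) ∩ {x | ∑ i, x i < 1} := by ext; simp
    rw [this]
    exact (isOpen_iInter_of_finite fun i => isOpen_lt continuous_const (continuous_apply i)).inter
      (isOpen_lt (by fun_prop) continuous_const)

theorem mem_boundary_iff_norm {k : ℕ} (u : Fin k → I) :
    u ∈ Cube.boundary (Fin k) ↔ ‖fun i => 2 * (u i : ℝ) - 1‖ = 1 := by
  constructor
  · rintro ⟨i, hi⟩
    refine le_antisymm (norm_two_mul_sub_one_le u) ?_
    refine le_trans ?_ (norm_le_pi_norm (fun i => 2 * (u i : ℝ) - 1) i)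
    rcases hi with hi | hi <;> (simp [hi]; try norm_num)
  · intro h
    by_contra hcon
    simp only [Cube.boundary, mem_ofPred_eq, not_exists, not_or] at hcon
    refine h.not_lt ((pi_norm_lt_iff zero_lt_one).2 fun i => ?_)
    have h0 : (0 : ℝ) < u i := unitInterval.pos_iff_ne_zero.2 (hcon i).1
    have h1 : (u i : ℝ) < 1 := unitInterval.lt_one_iff_ne_one.2 (hcon i).2
    rw [Real.norm_eq_abs, abs_lt]
    constructor <;> linarith

/-- The standard simplex and its boundary are homeomorphic to a cube and its boundary. -/
theorem exists_cube_param_stdSimplex (k : ℕ) :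
    ∃ w : (Fin k → I) → Fin (k + 1) → ℝ, Continuous w ∧ Function.Injective w ∧
      range w = stdSimplex ℝ (Fin (k + 1)) ∧
      ∀ u, u ∈ Cube.boundary (Fin k) ↔ ∃ i, w u i = 0 := by
  have hne : (interior (cornerSimplex k)).Nonempty := by
    rw [interior_cornerSimplex]
    refine ⟨fun _ => 1 / (k + 1), fun i => by positivity, ?_⟩
    rw [Finset.sum_const, Finset.card_univ, Fintype.card_fin, nsmul_eq_mul, mul_one_div,
      div_lt_one (by positivity)]
    linarith
  -- The unit ball of the sup norm is the cube [-1, 1]^k, so this homeomorphism carries the corner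
  -- simplex and its frontier to a cube and its boundary.
  obtain ⟨ψ, -, h2, h3⟩ := exists_homeomorph_image_interior_closure_frontier_eq_unitBall
    (convex_cornerSimplex k) hne (isBounded_cornerSimplex k)
  rw [(isClosed_cornerSimplex k).closure_eq] at h2
  rw [(isClosed_cornerSimplex k).frontier_eq, interior_cornerSimplex] at h3
  let a : (Fin k → I) → Fin k → ℝ := fun u i => 2 * (u i : ℝ) - 1
  have ha : Continuous a := by fun_prop
  let x : (Fin k → I) → Fin k → ℝ := fun u => ψ.symm (a u)
  have hx : ∀ u, x u ∈ cornerSimplex k := fun u => by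
    have : a u ∈ ψ '' cornerSimplex k := by
      rw [h2, mem_closedBall_zero_iff]
      exact norm_two_mul_sub_one_le u
    obtain ⟨y, hy, hya⟩ := this
    change ψ.symm (a u) ∈ _
    rwa [← hya, ψ.symm_apply_apply]
  refine ⟨fun u => Fin.cons (1 - ∑ i, x u i) (x u), ?_, ?_, ?_, ?_⟩
  · have : Continuous x := ψ.symm.continuous.comp ha
    refine continuous_pi fun i => ?_
    refine Fin.cases ?_ (fun j => ?_) i
    · simp only [Fin.cons_zero]; fun_prop
    · simp only [Fin.cons_succ]; fun_prop
  · intro u v huv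
    have h1 : x u = x v := (Fin.cons_inj.1 huv).2
    have h4 : a u = a v := ψ.symm.injective h1
    funext i
    have := congrFun h4 i
    simp only [a] at this
    exact Subtype.ext (by linarith)
  · ext w
    constructor
    · rintro ⟨u, rfl⟩
      refine ⟨fun i => ?_, ?_⟩
      · refine Fin.cases ?_ (fun j => ?_) i
        · simpa using (hx u).2
        · simpa using (hx u).1 j
      · simp [Fin.sum_univ_succ]
    · rintro ⟨hw, hw1⟩
      rw [Fin.sum_univ_succ] at hw1
      have hy : ψ (Fin.tail w) ∈ Metric.closedBall (0 : Fin k → ℝ) 1 := by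
        rw [← h2]
        refine mem_image_of_mem _ ⟨fun i => hw _, ?_⟩
        have := hw 0
        simp only [Fin.tail]
        linarith
      rw [mem_closedBall_zero_iff, pi_norm_le_iff_of_nonneg zero_le_one] at hy
      have hy' := fun i => abs_le.1 (hy i)
      refine ⟨fun i => ⟨(ψ (Fin.tail w) i + 1) / 2, by linarith [hy' i], by linarith [hy' i]⟩, ?_⟩
      have hau : a (fun i => ⟨(ψ (Fin.tail w) i + 1) / 2, by linarith [hy' i],
          by linarith [hy' i]⟩) = ψ (Fin.tail w) := by
        funext i
        simp only [a]
        ring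
      simp only [x, hau, ψ.symm_apply_apply]
      conv_rhs => rw [← Fin.cons_self_tail w]
      congr 1
      simp only [Fin.tail]
      linarith
  · intro u
    rw [mem_boundary_iff_norm]
    change ‖a u‖ = 1 ↔ _
    rw [← mem_sphere_zero_iff_norm, ← h3]
    have hxu : ψ (x u) = a u := ψ.apply_symm_apply _
    rw [← hxu, ψ.injective.mem_set_image, Fin.exists_fin_succ]
    simp only [Fin.cons_zero, Fin.cons_succ]
    constructor
    · rintro ⟨-, hn⟩
      by_contra hcon
      push Not at hcon
      refine hn ⟨fun i => lt_of_le_of_ne ((hx u).1 i) (hcon.2 i).symm, ?_⟩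
      exact lt_of_le_of_ne (hx u).2 fun h => hcon.1 (by linarith)
    · intro h
      refine ⟨hx u, fun hn => ?_⟩
      rcases h with h | ⟨i, h⟩
      · linarith [hn.2]
      · linarith [hn.1 i]

variable {V : Type*} [NormedAddCommGroup V] [NormedSpace ℝ V]

/-- A simplex and its boundary are homeomorphic to a cube and its boundary. -/
theorem exists_cube_param_simplex {s : Finset V} (hs : s.Nonempty)
    (hind : AffineIndependent ℝ ((↑) : s → V)) :
    ∃ (k : ℕ) (e : (Fin k → I) → V), Continuous e ∧ Function.Injective e ∧
      range e = convexHull ℝ (s : Set V) ∧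
      ∀ u, u ∈ Cube.boundary (Fin k) ↔ ∃ t ⊂ s, e u ∈ convexHull ℝ (t : Set V) := by
  classical
  obtain ⟨k, hk⟩ := Nat.exists_eq_succ_of_ne_zero hs.card_pos.ne'
  let v : Fin (k + 1) ≃ s := (s.equivFinOfCardEq hk).symm
  let p : Fin (k + 1) → V := fun i => v i
  have hp : Function.Injective p := Subtype.val_injective.comp v.injective
  have hps : range p = s := by
    rw [range_comp' , v.range_eq_univ]; simp
  have hpind : AffineIndependent ℝ p := hind.comp_embedding v.toEmbedding
  let Φ : (Fin (k + 1) → ℝ) → V := fun w => ∑ i, w i • p i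
  have hΦc : Continuous Φ := by fun_prop
  have hΦinj : ∀ w ∈ stdSimplex ℝ (Fin (k + 1)), ∀ w' ∈ stdSimplex ℝ (Fin (k + 1)),
      Φ w = Φ w' → w = w' := by
    intro w hw w' hw' h
    funext i
    have := affineIndependent_iff.1 hpind Finset.univ (fun i => w i - w' i)
      (by rw [Finset.sum_sub_distrib, hw.2, hw'.2, sub_self])
      (by simp only [sub_smul, Finset.sum_sub_distrib]; exact sub_eq_zero.2 h) i (Finset.mem_univ i)
    linarith
  obtain ⟨w, hwc, hwi, hwr, hwb⟩ := exists_cube_param_stdSimplex k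
  have hw : ∀ u, w u ∈ stdSimplex ℝ (Fin (k + 1)) := fun u => hwr ▸ mem_range_self u
  -- Points of the face t have barycentric coordinates vanishing off t. Since these coordinates are
  -- unique, lying in a proper face means that some coordinate is zero.
  have hsub : ∀ t ⊆ s, ∀ y ∈ convexHull ℝ (t : Set V), ∃ c ∈ stdSimplex ℝ (Fin (k + 1)),
      Φ c = y ∧ ∀ i, p i ∉ t → c i = 0 := by
    intro t hts y hy
    obtain ⟨c, hc0, hc1, hcy⟩ := Finset.mem_convexHull'.1 hy
    have himg : (Finset.univ.filter fun i => p i ∈ t).image p = t := by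
      ext y
      simp only [Finset.mem_image, Finset.mem_filter, Finset.mem_univ, true_and]
      constructor
      · rintro ⟨i, hi, rfl⟩
        exact hi
      · intro hyt
        obtain ⟨i, rfl⟩ : y ∈ range p := hps ▸ hts hyt
        exact ⟨i, hyt, rfl⟩
    refine ⟨fun i => if p i ∈ t then c (p i) else 0, ⟨fun i => ?_, ?_⟩, ?_, fun i hi => if_neg hi⟩
    · by_cases hi : p i ∈ t
      · simpa [hi] using hc0 _ hi
      · simp [hi]
    · rw [← Finset.sum_filter, ← Finset.sum_image (f := c) hp.injOn, himg, hc1]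
    · simp only [Φ, ite_smul, zero_smul]
      rw [← Finset.sum_filter, ← Finset.sum_image (f := fun y => c y • y) hp.injOn, himg, hcy]
  refine ⟨k, Φ ∘ w, hΦc.comp hwc, fun u u' h => hwi (hΦinj _ (hw u) _ (hw u') h), ?_, fun u => ?_⟩
  · apply Subset.antisymm
    · rintro _ ⟨u, rfl⟩
      refine (convex_convexHull ℝ _).sum_mem (fun i _ => (hw u).1 i) (hw u).2 fun i _ => ?_
      exact subset_convexHull ℝ _ (v i).2
    · intro y hy
      obtain ⟨c, hc, hcy, -⟩ := hsub s subset_rfl y hy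
      rw [← hwr] at hc
      obtain ⟨u, rfl⟩ := hc
      exact ⟨u, hcy⟩
  · rw [hwb]
    constructor
    · rintro ⟨i, hi⟩
      refine ⟨s.erase (p i), Finset.erase_ssubset (v i).2, ?_⟩
      have : (Φ ∘ w) u = ∑ j ∈ Finset.univ.erase i, w u j • p j := by
        rw [Finset.sum_erase _ (by rw [hi, zero_smul])]; rfl
      rw [this]
      refine (convex_convexHull ℝ _).sum_mem (fun j _ => (hw u).1 j) ?_ fun j hj => ?_
      · rw [Finset.sum_erase _ hi]
        exact (hw u).2
      · refine subset_convexHull ℝ _ ?_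
        rw [Finset.coe_erase]
        exact ⟨(v j).2, fun h => (Finset.mem_erase.1 hj).1 (hp h)⟩
    · rintro ⟨t, hts, ht⟩
      obtain ⟨c, hc, hcy, hct⟩ := hsub t hts.1 _ ht
      obtain ⟨y, hys, hyt⟩ := Finset.exists_of_ssubset hts
      obtain ⟨i, rfl⟩ : y ∈ range p := hps ▸ hys
      exact ⟨i, hΦinj _ hc _ (hw u) hcy ▸ hct i hyt⟩

end Simplex

/-! ### Lifting over products of manifolds and polyhedra -/

section Polyhedra

variable {V : Type*} [NormedAddCommGroup V] [NormedSpace ℝ V]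

/-- Simplices meet in common faces, so a simplex with fewest vertices among those containing p lies
in every other one. -/
theorem Geometry.SimplicialComplex.exists_carrier (K : Geometry.SimplicialComplex ℝ V) (p : K.space) :
    ∃ s ∈ K.faces, (p : V) ∈ convexHull ℝ (s : Set V) ∧
      ∀ t ∈ K.faces, (p : V) ∈ convexHull ℝ (t : Set V) → s ⊆ t := by
  classical
  obtain ⟨s₀, hs₀, hp₀⟩ := Geometry.SimplicialComplex.mem_space_iff.1 p.2
  obtain ⟨s, ⟨hs, hps⟩, hmin⟩ := exists_minimalFor_of_wellFoundedLT
    (fun s : Finset V => s ∈ K.faces ∧ (p : V) ∈ convexHull ℝ (s : Set V)) Finset.card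
    ⟨s₀, hs₀, hp₀⟩
  refine ⟨s, hs, hps, fun t ht hpt => ?_⟩
  have hst := K.inter_subset_convexHull hs ht ⟨hps, hpt⟩
  rw [← Finset.coe_inter] at hst
  have hne : (s ∩ t).Nonempty := by
    rw [← Finset.coe_nonempty, ← convexHull_nonempty_iff (𝕜 := ℝ)]
    exact ⟨_, hst⟩
  have hcard := hmin ⟨K.down_closed hs Finset.inter_subset_left hne, hst⟩
    (Finset.card_le_card Finset.inter_subset_left)
  rw [← Finset.eq_of_subset_of_card_le Finset.inter_subset_left hcard]
  exact Finset.inter_subset_right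

theorem Geometry.SimplicialComplex.isCompact_space {K : Geometry.SimplicialComplex ℝ V}
    (hK : K.faces.Finite) : IsCompact K.space :=
  hK.isCompact_biUnion fun s _ => s.finite_toSet.isCompact_convexHull ℝ

variable {E B S : Type*} [TopologicalSpace E] [TopologicalSpace B] [TopologicalSpace S]
  [T2Space S] [SecondCountableTopology S]

/-- The corner map for ∂Iᵏ ⊂ Iᵏ is again cube lifting, hence lifts over the manifold pair;
adjunction returns the product pair. -/
theorem IsCubeLifting.liftsOn_prod_cube {q : C(E, B)} (hq : IsCubeLifting q) {A : Set S}
    (hA : IsClosed A) (hAs : ∀ s, IsSliceAt A s) {k : ℕ} {h : S × (Fin k → I) → B}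
    (hh : Continuous h) :
    LiftsOn q h ({z | z.1 ∈ A} ∪ {z | z.2 ∈ Cube.boundary (Fin k)}) univ :=
  LiftsOn.of_cornerMap (fun _ hh => (hq.cornerMap_cube k).liftsOn_of_isSliceAt hA hAs hh) hh

/-- A map with the right lifting property for all `(I^n, ∂I^n)` has it for the product of a manifold
pair with a polyhedral pair. -/
theorem IsCubeLifting.liftsOn_prod_space {q : C(E, B)} (hq : IsCubeLifting q) {A : Set S}
    (hA : IsClosed A) (hAs : ∀ s, IsSliceAt A s) {K L : Geometry.SimplicialComplex ℝ V}
    (hK : K.faces.Finite) (hLK : L ≤ K) {h : S × K.space → B} (hh : Continuous h) :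
    LiftsOn q h ({z | z.1 ∈ A} ∪ {z | (z.2 : V) ∈ L.space}) univ := by
  classical
  have hLK' : L.faces ⊆ K.faces := hLK
  choose car hcar hmem hmin using K.exists_carrier
  have hU : (⋃ s ∈ K.faces, {z : S × K.space | (z.2 : V) ∈ convexHull ℝ (s : Set V)}) = univ :=
    eq_univ_of_forall fun z => mem_biUnion (hcar z.2) (hmem z.2)
  have hcl : ∀ C : Set V, IsClosed C → IsClosed {z : S × K.space | (z.2 : V) ∈ C} := fun C hC =>
    hC.preimage (by fun_prop)
  have := LiftsOn.cells K.faces hK (fun s => {z : S × K.space | (z.2 : V) ∈ convexHull ℝ (s : Set V)})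
    Finset.card (fun z => car z.2) (fun s _ => hcl _ (s.finite_toSet.isClosed_convexHull ℝ))
    (fun s hs z hz => ⟨hcar _, hmem _, fun y hy => convexHull_mono
      (Finset.coe_subset.2 (hmin z.2 s hs hz)) hy, ?_⟩) (q := q) (h := h)
    (hA.preimage continuous_fst) (fun s hs => ?_) {z | (z.2 : V) ∈ L.space}
    (hcl _ (Geometry.SimplicialComplex.isCompact_space (hK.subset hLK')).isClosed)
    fun z hz => ⟨hcar _, hmem _, ?_⟩
  · rw [hU, union_univ] at this
    exact this
  · exact (hmin z.2 s hs hz).eq_or_ssubset.imp id Finset.card_lt_card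
  · obtain ⟨k, e, hec, hei, her, heb⟩ :=
      exists_cube_param_simplex (K.nonempty_of_mem_faces hs) (K.indep hs)
    have hes : ∀ u, e u ∈ convexHull ℝ (s : Set V) := fun u => her ▸ mem_range_self u
    let e' : (Fin k → I) → K.space := fun u =>
      ⟨e u, Geometry.SimplicialComplex.convexHull_subset_space hs (hes u)⟩
    have hec' : Continuous e' := by fun_prop
    have he' : IsEmbedding (Prod.map (id : S → S) e') :=
      IsEmbedding.id.prodMap (hec'.isClosedEmbedding fun u v huv =>
        hei (congrArg Subtype.val huv)).isEmbedding
    have hbd : ∀ u, u ∈ Cube.boundary (Fin k) ↔ car (e' u) ≠ s := by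
      intro u
      rw [heb]
      constructor
      · rintro ⟨t, hts, htu⟩ hcs
        have htne : t.Nonempty := by
          rw [← Finset.coe_nonempty, ← convexHull_nonempty_iff (𝕜 := ℝ)]
          exact ⟨_, htu⟩
        have := hmin (e' u) t (K.down_closed hs hts.1 htne) htu
        rw [hcs] at this
        exact hts.2 this
      · intro hne
        exact ⟨car (e' u), ((hmin (e' u) s hs (hes u)).eq_or_ssubset).resolve_left hne, hmem (e' u)⟩
    -- The cell over s is S times a simplex; parametrizing the simplex by a cube reduces it to the
    -- product case.
    have key := LiftsOn.image he' (h := h) (hq.liftsOn_prod_cube hA hAs (k := k)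
      (h := h ∘ Prod.map id e') (hh.comp he'.continuous))
    have himg : ∀ z : S × K.space, (z.2 : V) ∈ convexHull ℝ (s : Set V) →
        ∃ u, Prod.map id e' (z.1, u) = z := by
      rintro ⟨x, p⟩ hp
      obtain ⟨u, hu⟩ : (p : V) ∈ range e := her ▸ hp
      exact ⟨u, Prod.ext rfl (Subtype.ext hu)⟩
    convert key using 1
    · ext z
      constructor
      · rintro (⟨hz, hz'⟩ | ⟨hz, hz'⟩)
        · obtain ⟨u, hu⟩ := himg z hz
          refine ⟨(z.1, u), Or.inr ((hbd u).2 ?_), hu⟩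
          have h2 : e' u = z.2 := congrArg Prod.snd hu
          rwa [h2]
        · obtain ⟨u, hu⟩ := himg z hz
          exact ⟨(z.1, u), Or.inl hz', hu⟩
      · rintro ⟨⟨x, u⟩, hu | hu, rfl⟩
        · exact Or.inr ⟨hes u, hu⟩
        · exact Or.inl ⟨hes u, (hbd u).1 hu⟩
    · ext z
      constructor
      · intro hz
        obtain ⟨u, hu⟩ := himg z hz
        exact ⟨_, trivial, hu⟩
      · rintro ⟨⟨x, u⟩, -, rfl⟩
        exact hes u
  · obtain ⟨s, hs, hzs⟩ := Geometry.SimplicialComplex.mem_space_iff.1 hz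
    intro y hy
    exact Geometry.SimplicialComplex.mem_space_iff.2
      ⟨s, hs, convexHull_mono (Finset.coe_subset.2 (hmin z.2 s (hLK' hs) hzs)) hy⟩

end Polyhedra

/-! ### Stein submanifolds -/

section Stein

variable {a b : ℕ} {S T : Type*} [TopologicalSpace S] [ChartedSpace (Cn a) S]
  [TopologicalSpace T] [ChartedSpace (Cn b) T] {ι : T → S}

theorem isClosed_holomorphicHull (K : Set S) : IsClosed (holomorphicHull (a := a) K) := by
  have : holomorphicHull (a := a) K = ⋂ φ : {φ : S → ℂ // MDifferentiable 𝓘(ℂ, Cn a) 𝓘(ℂ) φ},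
      ⋂ C : {C : ℝ // ∀ y ∈ K, ‖φ.1 y‖ ≤ C}, {x | ‖φ.1 x‖ ≤ C} := by
    ext x; simp [holomorphicHull]
  rw [this]
  refine isClosed_iInter fun φ => isClosed_iInter fun C => ?_
  have := φ.2.continuous
  exact isClosed_le (by fun_prop) continuous_const

theorem IsSteinInclusion.holomorphic (hι : IsSteinInclusion b a ι) :
    IsHolomorphic (m := b) (n := a) ι :=
  hι.isEmbedding.contMDiff.mdifferentiable (by simp)

/-- A closed complex submanifold of a Stein manifold is Stein. -/
theorem IsSteinInclusion.isSteinManifold (hι : IsSteinInclusion b a ι) : IsSteinManifold b T where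
  t2Space := by
    have := hι.stein.t2Space
    exact hι.isEmbedding.isEmbedding.t2Space
  secondCountable := by
    have := hι.stein.secondCountable
    exact hι.isEmbedding.isEmbedding.secondCountableTopology
  isManifold := hι.isManifold
  holomorphicallyConvex K hK := by
    have hce : IsClosedEmbedding ι := ⟨hι.isEmbedding.isEmbedding, hι.isClosed_range⟩
    -- Holomorphic functions on S restrict to T, so the hull of K in T lies in the preimage of the
    -- hull of its image; that preimage is compact as ι is a closed embedding.
    refine (hce.isCompact_preimage (hι.stein.holomorphicallyConvex (ι '' K)
      (hK.image hce.continuous))).of_isClosed_subset (isClosed_holomorphicHull K) ?_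
    intro x hx φ hφ C hC
    exact hx (φ ∘ ι) (hφ.comp hι.holomorphic) C fun y hy => hC _ ⟨y, hy, rfl⟩
  separatesPoints x y hxy := by
    obtain ⟨φ, hφ, hne⟩ := hι.stein.separatesPoints (ι x) (ι y) fun h =>
      hxy (hι.isEmbedding.isEmbedding.injective h)
    exact ⟨φ ∘ ι, hφ.comp hι.holomorphic, hne⟩

/-- The empty manifold of dimension `0`. -/
@[reducible] noncomputable def emptyChartedSpace : ChartedSpace (Cn 0) Empty := ChartedSpace.empty _ _

/-- Allows interpolation results to be applied with no interpolation condition. -/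
theorem IsSteinManifold.isSteinInclusion_empty (hS : IsSteinManifold a S) :
    letI := emptyChartedSpace
    IsSteinInclusion 0 a (Empty.elim : Empty → S) := by
  let _ := emptyChartedSpace
  refine ⟨hS, inferInstance, ⟨⟨Cn a, inferInstance, inferInstance, fun x => x.elim⟩,
    .of_subsingleton _⟩, ?_⟩
  rw [range_eq_empty]
  exact isClosed_empty

theorem IsSteinInclusion.isSliceAt (hι : IsSteinInclusion b a ι) (s : S) :
    IsSliceAt (range ι) s := by
  by_cases hs : s ∈ range ι
  · obtain ⟨t, rfl⟩ := hs
    exact isSliceAt_range (a := a) (b := b) hι.isEmbedding t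
  · exact isSliceAt_of_notMem (a := a) hι.isClosed_range hs

end Stein

/-! ### Passing the Oka property along an intermediate fibration -/

section Oka

theorem Topology.IsEmbedding.continuousOn_extend {W Z E : Type*} [TopologicalSpace W]
    [TopologicalSpace Z] [TopologicalSpace E] {e : W → Z} (he : IsEmbedding e) {w : W → E}
    (hw : Continuous w) (g : Z → E) : ContinuousOn (Function.extend e w g) (range e) := by
  rintro _ ⟨z, rfl⟩
  have hz := hw.continuousAt (x := z)
  rw [ContinuousWithinAt, ← he.map_nhds_eq, Filter.tendsto_map'_iff, he.injective.extend_apply]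
  exact Filter.Tendsto.congr (fun x => (he.injective.extend_apply w g x).symm) hz

theorem ContinuousMap.Homotopy.trans_apply_cases {Z X : Type*} [TopologicalSpace Z]
    [TopologicalSpace X] {f₀ f₁ f₂ : C(Z, X)} (F : f₀.Homotopy f₁) (G : f₁.Homotopy f₂) (t : I)
    (z : Z) : (∃ t', F.trans G (t, z) = F (t', z)) ∨ ∃ t', F.trans G (t, z) = G (t', z) := by
  rw [ContinuousMap.Homotopy.trans_apply]
  split_ifs with h
  · exact Or.inl ⟨_, rfl⟩
  · exact Or.inr ⟨_, rfl⟩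

variable {m n : ℕ} {X Y : Type*} [TopologicalSpace X] [ChartedSpace (Cn m) X]
  [TopologicalSpace Y] [ChartedSpace (Cn n) Y] {f : X → Y}

/-- The source of an intermediate fibration over an Oka manifold is Oka. -/
theorem IsIntermediateFibration.hasParametricOka_source
    (hf : IsIntermediateFibration (m := m) (n := n) f) (hY : HasParametricOka n Y) :
    HasParametricOka m X := by
  intro a b S T _ _ _ _ ι hι d K L hK hLK g hgL hgT _
  have := hι.stein.t2Space
  have := hι.stein.secondCountable
  let q : C(X, Y) := ⟨f, hf.fibration.1⟩
  obtain ⟨G, hG0, hG1, hGL, hGT, -⟩ := hY a b S T ι hι d K L hK hLK (q.comp g)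
    (fun p hp => hf.holomorphic.comp (hgL p hp)) (fun p => hf.holomorphic.comp (hgT p))
    fun _ => mdifferentiable_const
  let q₁ : C(C(I, X), Corner q ({0} : Set I)) := ⟨cornerMap q {0}, continuous_cornerMap q {0}⟩
  have hq₁ : IsCubeLifting q₁ := IsSerreFibration.cornerMap_interval (q := q) hf.fibration
  -- The deformation G is lifted to X, starting from g at time 0 and constant in time over T × P and
  -- S × Q. By adjunction this is a lifting problem for `q₁`, which is cube lifting.
  obtain ⟨H, hHc, hHg, hHq⟩ := LiftsOn.of_cornerMap (q := q) (N := ({0} : Set I))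
    (A := {z : S × K.space | z.1 ∈ range ι} ∪ {z | (z.2 : EuclideanSpace ℝ (Fin d)) ∈ L.space})
    (fun h hh => hq₁.liftsOn_prod_space hι.isClosed_range hι.isSliceAt hK hLK hh)
    (map_continuous G) (fun w => g w.1) (Continuous.continuousOn (by fun_prop)) (by
      rintro ⟨⟨s, p⟩, t⟩ ((⟨x, rfl⟩ | hp) | ht)
      · exact (hGT x p t).symm
      · exact (hGL s p t hp).symm
      · obtain rfl : t = 0 := ht
        exact (hG0 _).symm)
  rw [continuousOn_univ] at hHc
  have hH0 : ∀ z, H (z, 0) = g z := fun z => hHg (Or.inr rfl)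
  have hHL : ∀ s (p : K.space) t, (p : EuclideanSpace ℝ (Fin d)) ∈ L.space →
      H ((s, p), t) = g (s, p) := fun s p t hp => hHg (Or.inl (Or.inr hp))
  have hHT : ∀ x (p : K.space) t, H ((ι x, p), t) = g (ι x, p) :=
    fun x p t => hHg (Or.inl (Or.inl ⟨x, rfl⟩))
  let g₁ : C(S × K.space, X) := ⟨fun z => H (z, 1), by fun_prop⟩
  have hfg₁ : ∀ z, f (g₁ z) = G (z, 1) := fun z => hHq (z, 1) trivial
  obtain ⟨G', h0, h1, hL, hT, -⟩ := hf.popi a b S T ι hι d K L hK hLK g₁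
    (fun p hp => by
      have : (fun s => g₁ (s, p)) = fun s => g (s, p) := funext fun s => hHL s p 1 hp
      rw [this]; exact hgL p hp)
    (fun p => by
      have : (fun x => g₁ (ι x, p)) = fun x => g (ι x, p) := funext fun x => hHT x p 1
      rw [this]; exact hgT p)
    (fun p => by simpa only [hfg₁] using hG1 p)
  let F₁ : g.Homotopy g₁ := ⟨⟨fun z => H (z.2, z.1), by fun_prop⟩, hH0, fun _ => rfl⟩
  let F₂ : g₁.Homotopy ⟨fun z => G' (z, 1), by fun_prop⟩ :=
    ⟨⟨fun z => G' (z.2, z.1), by fun_prop⟩, h0, fun _ => rfl⟩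
  refine ⟨⟨fun w => F₁.trans F₂ (w.2, w.1), by fun_prop⟩, fun z => ?_, fun p => ?_,
    fun s p t hp => ?_, fun x p t => ?_, fun _ _ => rfl⟩
  · exact (F₁.trans F₂).apply_zero z
  · have : ∀ s, F₁.trans F₂ (1, (s, p)) = G' ((s, p), 1) := fun s =>
      (F₁.trans F₂).apply_one (s, p)
    simpa only [ContinuousMap.coe_mk, this] using h1 p
  · rcases F₁.trans_apply_cases F₂ t (s, p) with ⟨t', ht'⟩ | ⟨t', ht'⟩
    · exact ht'.trans (hHL s p t' hp)
    · exact ht'.trans ((hL s p t' hp).trans (hHL s p 1 hp))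
  · rcases F₁.trans_apply_cases F₂ t (ι x, p) with ⟨t', ht'⟩ | ⟨t', ht'⟩
    · exact ht'.trans (hHT x p t')
    · exact ht'.trans ((hT x p t').trans (hHT x p 1))

/-- Lifts of families of holomorphic maps on a Stein manifold through an acyclic intermediate
fibration, with interpolation on a closed submanifold. -/
theorem IsIntermediateFibration.exists_holomorphic_lift
    (hf : IsIntermediateFibration (m := m) (n := n) f) (hcube : IsCubeLifting f)
    {a b : ℕ} {S T : Type} [TopologicalSpace S] [ChartedSpace (Cn a) S] [TopologicalSpace T]
    [ChartedSpace (Cn b) T] {ι : T → S} (hι : IsSteinInclusion b a ι) {d : ℕ}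
    {K : Geometry.SimplicialComplex ℝ (EuclideanSpace ℝ (Fin d))} (hK : K.faces.Finite)
    (h : C(S × K.space, Y)) (hh : ∀ p, IsHolomorphic (m := a) (n := n) fun s => h (s, p))
    (g : C(T × K.space, X)) (hg : ∀ p, IsHolomorphic (m := b) (n := m) fun t => g (t, p))
    (hgh : ∀ t p, f (g (t, p)) = h (ι t, p)) :
    ∃ g' : C(S × K.space, X), (∀ p, IsHolomorphic (m := a) (n := m) fun s => g' (s, p)) ∧
      (∀ z, f (g' z) = h z) ∧ ∀ t p, g' (ι t, p) = g (t, p) := by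
  have := hι.stein.t2Space
  have := hι.stein.secondCountable
  let q : C(X, Y) := ⟨f, hf.fibration.1⟩
  have he : IsEmbedding (Prod.map ι (id : K.space → K.space)) :=
    hι.isEmbedding.isEmbedding.prodMap .id
  -- The values off T × P are arbitrary and serve only to make u total.
  let u : S × K.space → X := Function.extend (Prod.map ι id) g fun z => Function.surjInv hcube.1 (h z)
  have hu : ∀ t p, u (ι t, p) = g (t, p) := fun t p => he.injective.extend_apply _ _ (t, p)
  obtain ⟨g₀, hg₀c, hg₀g, hg₀h⟩ := IsCubeLifting.liftsOn_prod_space (q := q) hcube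
    hι.isClosed_range hι.isSliceAt hK (bot_le : ⊥ ≤ K) (map_continuous h) u
    ((he.continuousOn_extend (map_continuous g) _).mono (by
      rintro ⟨s, p⟩ (⟨t, rfl⟩ | hp)
      · exact ⟨(t, p), rfl⟩
      · simp [Geometry.SimplicialComplex.space_bot] at hp)) (by
      rintro ⟨s, p⟩ (⟨t, rfl⟩ | hp)
      · rw [hu]; exact hgh t p
      · simp [Geometry.SimplicialComplex.space_bot] at hp)
  have hg₀T : ∀ t p, g₀ (ι t, p) = g (t, p) := fun t p =>
    (hg₀g (Or.inl ⟨t, rfl⟩)).trans (hu t p)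
  -- POPI with Q = ∅ makes the continuous lift holomorphic. As the deformation preserves the
  -- composite with f, the result is still a lift of h.
  obtain ⟨G, -, hG1, -, hGT, hGf⟩ := hf.popi a b S T ι hι d K ⊥ hK bot_le
    ⟨g₀, continuousOn_univ.1 hg₀c⟩
    (fun p hp => by simp [Geometry.SimplicialComplex.space_bot] at hp)
    (fun p => by simpa only [ContinuousMap.coe_mk, hg₀T] using hg p)
    (fun p => by
      have : (fun s => f (g₀ (s, p))) = fun s => h (s, p) := funext fun s => hg₀h (s, p) trivial
      exact this ▸ hh p)
  exact ⟨⟨fun z => G (z, 1), by fun_prop⟩, hG1, fun z => (hGf z 1).trans (hg₀h z trivial),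
    fun t p => (hGT t p 1).trans (hg₀T t p)⟩

/-- The target of an acyclic intermediate fibration with Oka source is Oka. -/
theorem IsIntermediateFibration.hasParametricOka_target
    (hf : IsIntermediateFibration (m := m) (n := n) f) (hw : IsWeakHomotopyEquiv f)
    (hX : HasParametricOka m X) : HasParametricOka n Y := by
  classical
  intro a b S T _ _ _ _ ι hι d K L hK hLK h hhL hhT _
  have := hι.stein.t2Space
  have := hι.stein.secondCountable
  have hcube : IsCubeLifting f := hf.fibration.isCubeLifting hw
  let q : C(X, Y) := ⟨f, hf.fibration.1⟩
  have hιc : Continuous ι := hι.isEmbedding.isEmbedding.continuous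
  have hLK' : L.faces ⊆ K.faces := hLK
  have hsub : L.space ⊆ K.space := biUnion_subset_biUnion_left hLK'
  let j : L.space → K.space := inclusion hsub
  have hj : Continuous j := continuous_inclusion hsub
  let _ := emptyChartedSpace
  -- T is itself Stein, so h over T × P lifts holomorphically, with the empty set as interpolation
  -- locus.
  obtain ⟨gT, hgT, hgTh, -⟩ := hf.exists_holomorphic_lift hcube
    hι.isSteinManifold.isSteinInclusion_empty hK
    (h.comp ⟨Prod.map ι id, by fun_prop⟩) hhT ⟨fun z => z.1.elim, by fun_prop⟩
    (fun _ x => x.elim) (fun x => x.elim)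
  -- The lift over S × Q interpolates `gT` on T × Q, so that the two partial lifts glue.
  obtain ⟨gL, hgL, hgLh, hgLT⟩ := hf.exists_holomorphic_lift hcube hι (hK.subset hLK')
    (h.comp ⟨Prod.map id j, by fun_prop⟩) (fun p => hhL (j p) p.2)
    (gT.comp ⟨Prod.map id j, by fun_prop⟩) (fun p => hgT (j p)) (fun t p => hgTh (t, j p))
  have heT : IsEmbedding (Prod.map ι (id : K.space → K.space)) :=
    hι.isEmbedding.isEmbedding.prodMap .id
  have heL : IsEmbedding (Prod.map (id : S → S) j) :=
    IsEmbedding.id.prodMap (IsEmbedding.inclusion hsub)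
  let sec : S × K.space → X := fun z => Function.surjInv hcube.1 (h z)
  let uT : S × K.space → X := Function.extend (Prod.map ι id) gT sec
  let uL : S × K.space → X := Function.extend (Prod.map id j) gL sec
  have huT : ∀ t p, uT (ι t, p) = gT (t, p) := fun t p => heT.injective.extend_apply _ _ (t, p)
  have huL : ∀ s p, uL (s, j p) = gL (s, p) := fun s p => heL.injective.extend_apply _ _ (s, p)
  let u : S × K.space → X := fun z =>
    if (z.2 : EuclideanSpace ℝ (Fin d)) ∈ L.space then uL z else uT z
  have huuL : EqOn u uL {z | (z.2 : EuclideanSpace ℝ (Fin d)) ∈ L.space} :=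
    fun z (hz : (z.2 : EuclideanSpace ℝ (Fin d)) ∈ L.space) => by simp [u, hz]
  have huuT : EqOn u uT {z | z.1 ∈ range ι} := by
    rintro ⟨s, p⟩ ⟨t, rfl⟩
    by_cases hp : (p : EuclideanSpace ℝ (Fin d)) ∈ L.space
    · exact (huuL hp).trans ((huL (ι t) ⟨p, hp⟩).trans
        ((hgLT t ⟨p, hp⟩).trans (huT t p).symm))
    · simp [u, hp]
  have huc : ContinuousOn u ({z | z.1 ∈ range ι} ∪
      {z | (z.2 : EuclideanSpace ℝ (Fin d)) ∈ L.space}) := by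
    refine ContinuousOn.union_of_isClosed ?_ ?_ (hι.isClosed_range.preimage continuous_fst)
      ((Geometry.SimplicialComplex.isCompact_space (hK.subset hLK')).isClosed.preimage (by fun_prop))
    · refine ((heT.continuousOn_extend (map_continuous gT) sec).mono ?_).congr huuT
      rintro ⟨s, p⟩ ⟨t, rfl⟩
      exact ⟨(t, p), rfl⟩
    · refine ((heL.continuousOn_extend (map_continuous gL) sec).mono ?_).congr huuL
      rintro ⟨s, p⟩ hp
      exact ⟨(s, ⟨p, hp⟩), rfl⟩
  obtain ⟨g, hgc, hgu, hgh⟩ := IsCubeLifting.liftsOn_prod_space (q := q) hcube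
    hι.isClosed_range hι.isSliceAt hK hLK (map_continuous h) u huc (by
      rintro ⟨s, p⟩ (⟨t, rfl⟩ | hp)
      · rw [huuT ⟨t, rfl⟩, huT]
        exact hgTh (t, p)
      · rw [huuL hp]
        exact (congrArg f (huL s ⟨p, hp⟩)).trans (hgLh (s, ⟨p, hp⟩)))
  have hgT' : ∀ t p, g (ι t, p) = gT (t, p) := fun t p =>
    (hgu (Or.inl ⟨t, rfl⟩)).trans ((huuT ⟨t, rfl⟩).trans (huT t p))
  have hgL' : ∀ s p, g (s, j p) = gL (s, p) := fun s p =>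
    (hgu (Or.inr p.2)).trans ((huuL p.2).trans (huL s p))
  have hfg : ∀ z, f (g z) = h z := fun z => hgh z trivial
  obtain ⟨G, hG0, hG1, hGL, hGT, -⟩ := hX a b S T ι hι d K L hK hLK ⟨g, continuousOn_univ.1 hgc⟩
    (fun p hp => by
      have : (fun s => g (s, p)) = fun s => gL (s, ⟨p, hp⟩) := funext fun s => hgL' s ⟨p, hp⟩
      exact this ▸ hgL ⟨p, hp⟩)
    (fun p => by simpa only [ContinuousMap.coe_mk, hgT'] using hgT p)
    (fun _ => mdifferentiable_const)
  -- Since f ∘ g = h, the image under f of the deformation of g is a deformation of h, fixed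
  -- wherever G is.
  refine ⟨q.comp G, fun z => ?_, fun p => hf.holomorphic.comp (hG1 p), fun s p t hp => ?_,
    fun x p t => ?_, fun _ _ => rfl⟩
  · exact (congrArg f (hG0 z)).trans (hfg z)
  · exact (congrArg f (hGL s p t hp)).trans (hfg _)
  · exact (congrArg f (hGT x p t)).trans (hfg _)

end Oka

theorem theorem3 {m n : ℕ} {X Y : Type*}
    [TopologicalSpace X] [T2Space X] [SecondCountableTopology X]
    [ChartedSpace (Cn m) X] [IsManifold 𝓘(ℂ, Cn m) ω X]
    [TopologicalSpace Y] [T2Space Y] [SecondCountableTopology Y]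
    [ChartedSpace (Cn n) Y] [IsManifold 𝓘(ℂ, Cn n) ω Y]
    (f : X → Y) (hf : IsIntermediateFibration (m := m) (n := n) f) :
    (HasParametricOka n Y → HasParametricOka m X) ∧
      (IsWeakHomotopyEquiv f → HasParametricOka m X → HasParametricOka n Y) :=
  ⟨hf.hasParametricOka_source, hf.hasParametricOka_target⟩
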